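/- Let $n\in\mathbb N$, $\mathcal O=\mathbb C[[t]]$, $\mathcal K=\mathbb C((t))$, $G=SL_n$ and $G'=PSL_n$ (the adjoint algebraic group over $\mathbb C$, so $G'(R)=GL_n(R)/R^\times$ for every local ring $R$). Let $\mathcal G'=G'(\mathcal K)/G'(\mathcal O)$ be the affine Grassmannian of $G'$, with its ind-Zariski topology and the action of $G(\mathcal K)$ by left translation. A coweight is the class of some $\mu\in\mathbb Z^n$ modulo $\mathbb Z(1,\dots,1)$; it defines the point of $\mathcal G'$, again denoted $\mu$, represented by $\mathrm{diag}(t^{-\mu_1},\dots,t^{-\mu_n})$, whose stabilizer in $G(\mathcal K)$ is the parahoric subgroup $$\mathcal P_\mu=\{A\in SL_n(\mathcal K)\mid \text{if } t^k \text{ occurs in the entry } A_{ij},\text{ then } (\epsilon_i-\epsilon_j,\mu)+k\ge 0\}.$$ Put $\mathcal Q_{\mu,\nu}=\mathcal P_\mu\cap\mathcal P_\nu$. For a word $w=(i_1,\dots,i_N)$ in the alphabet $\{1,\dots,n\}$ let $\mu_j^w=\epsilon_{i_1}+\dots+\epsilon_{i_j}$, $0\le j\le N$. Fix a word $c$ of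 length $N$ (the center; the construction is independent of it up to canonical isomorphism) and write $\mu_j=\mu_j^c$. The Bott--Samelson variety of type $(1,\dots,1)$ ($N$ entries) is $$\Sigma=\mathcal P_{\mu_0}\times_{\mathcal Q_{\mu_0,\mu_1}}\mathcal P_{\mu_1}\times\cdots\times_{\mathcal Q_{\mu_{N-1},\mu_N}}\mathcal P_{\mu_N}/\mathcal P_{\mu_N},$$ the quotient of $\prod_j\mathcal P_{\mu_j}$ by $(p_0,\dots,p_N)\sim(p_0q_0,\,q_0^{-1}p_1q_1,\,\dots,\,q_{N-1}^{-1}p_Nq_N)$ with $q_j\in\mathcal Q_{\mu_j,\mu_{j+1}}$ for $j<N$ and $q_N\in\mathcal P_{\mu_N}$. Let $\pi:\Sigma\to\mathcal G'$ be the map $\pi([p_0,\dots,p_N])=p_0\cdots p_{N-1}\,\mu_N$. The torus fixed point $y_w\in\Sigma$ of a word $w$ of length $N$ is the point $[p_0,\dots,p_N]$ with $p_0\cdots p_{j-1}\,\mu_j=\mu^w_j$ in $\mathcal G'$ for $0\le j\le N$. Let $\eta(s)=\mathrm{diag}(s^{a_1},\dots,s^{a_n})$ with integers $a_1<\dots<a_n$,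 $\sum_i a_i=0$, be a generic anti-dominant one-parameter subgroup, acting on $\Sigma$ by left multiplication on $p_0$. The cell of $w$ is $$C_w=\{x\in\Sigma\mid \lim_{s\to0}\eta(s)x=y_w\},$$ where the limit is taken in the classical (complex) topology of $\Sigma$. **Lemma.** Let $w_1,w_2$ be words of length $N$ that are related by a single Knuth relation, that is, for some words $v_1,v_2$ and letters $x,y,z$ either - $\{w_1,w_2\}=\{v_1\,yxz\,v_2,\ v_1\,yzx\,v_2\}$ with $x\le y<z$, or - $\{w_1,w_2\}=\{v_1\,xzy\,v_2,\ v_1\,zxy\,v_2\}$ with $x<y\le z$. Then $\overline{\pi(C_{w_1})}=\overline{\pi(C_{w_2})}$, the closures being the Zariski closures in $\mathcal G'$ (equivalently, in the closed Schubert variety $X_{N\epsilon_1}=\overline{G(\mathcal O)\cdot N\epsilon_1}$, in which $\pi$ takes its values). -/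

import Mathlib

open scoped MatrixGroups LaurentSeries PowerSeries Topology

namespace KnuthMV

/-! ### Words and Knuth relations -/

/-- Two words are related by a single Knuth relation (the alphabet `{1, …, n}` is `Fin n`):
`u = v₁ x z y v₂`, `w = v₁ z x y v₂` with `x < y ≤ z`, or
`u = v₁ y z x v₂`, `w = v₁ y x z v₂` with `x ≤ y < z`. -/
inductive KnuthRelation {n : ℕ} : List (Fin n) → List (Fin n) → Prop
  | xzy_zxy (v₁ v₂ : List (Fin n)) (x y z : Fin n) (hxy : x < y) (hyz : y ≤ z) :
      KnuthRelation (v₁ ++ [x, z, y] ++ v₂) (v₁ ++ [z, x, y] ++ v₂)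
  | yzx_yxz (v₁ v₂ : List (Fin n)) (x y z : Fin n) (hxy : x ≤ y) (hyz : y < z) :
      KnuthRelation (v₁ ++ [y, z, x] ++ v₂) (v₁ ++ [y, x, z] ++ v₂)

/-- The `j`-th vertex `μ_j = ε_{i₁} + ⋯ + ε_{i_j}` of the polyline of the word `(i₁, …, i_N)`.
Coweights of `PSL_n` are classes of integer vectors modulo `(1, …, 1)`; we work with
representatives, and everything below depends on the differences `μ i - μ j` only. -/
def vertex {n : ℕ} (w : List (Fin n)) (j : ℕ) : Fin n → ℤ :=
  fun i => ((w.take j).count i : ℤ)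

/-! ### The affine Grassmannian of `PSL_n` -/

/-- The subgroup `G'(𝒪)` of `G'(𝒦)`, where `G' = PSL_n` as an algebraic group over `ℂ`,
`𝒪 = ℂ⟦t⟧`, `𝒦 = ℂ((t))`. For a local ring `R` the group of `R`-points of the algebraic group
`PSL_n = PGL_n` is `GL_n(R) / Rˣ`. -/
noncomputable def integralPoints (n : ℕ) : Subgroup PGL(n, ℂ⸨X⸩) :=
  ((Matrix.ProjGenLinGroup.mk (n := Fin n) (R := ℂ⸨X⸩)).comp
    (Matrix.GeneralLinearGroup.map (n := Fin n) (algebraMap ℂ⟦X⟧ ℂ⸨X⸩))).range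

/-- The affine Grassmannian `𝒢' = G'(𝒦) / G'(𝒪)` of `G' = PSL_n`. -/
def AffineGrassmannian (n : ℕ) : Type := PGL(n, ℂ⸨X⸩) ⧸ integralPoints n

/-- `G'(𝒦)` acts on `𝒢'` by left translation. -/
noncomputable instance (n : ℕ) : MulAction PGL(n, ℂ⸨X⸩) (AffineGrassmannian n) :=
  inferInstanceAs (MulAction PGL(n, ℂ⸨X⸩) (PGL(n, ℂ⸨X⸩) ⧸ integralPoints n))

/-- The canonical map `GL_n(𝒦) → 𝒢'`. -/
noncomputable def AffineGrassmannian.ofGL {n : ℕ} (g : GL (Fin n) ℂ⸨X⸩) : AffineGrassmannian n :=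
  QuotientGroup.mk (Matrix.ProjGenLinGroup.mk g)

/-- The part of `GL_n(𝒦)` of the matrices `g` such that all entries of `g` and of `g⁻¹` have a pole
of order at most `a`. -/
def boundedGL (n a : ℕ) : Set (GL (Fin n) ℂ⸨X⸩) :=
  {g | ∀ i j, ∀ k : ℤ, k < -(a : ℤ) →
    (g.1 i j).coeff k = 0 ∧ ((g⁻¹ : GL (Fin n) ℂ⸨X⸩).1 i j).coeff k = 0}

/-- The coordinates of `g`: the Laurent coefficients of the entries of `g` and of `g⁻¹`. -/
noncomputable def coordinates {n : ℕ} (g : GL (Fin n) ℂ⸨X⸩) : (Fin n × Fin n × ℤ) ⊕ (Fin n × Fin n × ℤ) → ℂ :=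
  Sum.elim (fun v => (g.1 v.1 v.2.1).coeff v.2.2)
    (fun v => ((g⁻¹ : GL (Fin n) ℂ⸨X⸩).1 v.1 v.2.1).coeff v.2.2)

/-- The Zariski topology on `σ → ℂ`: the closed sets are the common zero sets of families of
polynomials in the variables `σ`. -/
@[reducible] noncomputable def zariski (σ : Type) : TopologicalSpace (σ → ℂ) :=
  TopologicalSpace.induced
    (MvPolynomial.pointToPoint : (σ → ℂ) → PrimeSpectrum (MvPolynomial σ ℂ)) inferInstance

/-- The ind-Zariski topology on `GL_n(𝒦)`: a set is closed iff for every `a` its intersection with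
`boundedGL n a` is cut out there by polynomials in the coordinates. -/
@[reducible] noncomputable def zariskiGL (n : ℕ) : TopologicalSpace (GL (Fin n) ℂ⸨X⸩) :=
  ⨆ a : ℕ, TopologicalSpace.coinduced (Subtype.val : boundedGL n a → GL (Fin n) ℂ⸨X⸩)
    (TopologicalSpace.induced (fun g : boundedGL n a => coordinates g.1) (zariski _))

/-- The ind-Zariski topology on `𝒢'`, as the quotient of `GL_n(𝒦)`. -/
noncomputable instance (n : ℕ) : TopologicalSpace (AffineGrassmannian n) :=
  TopologicalSpace.coinduced AffineGrassmannian.ofGL (zariskiGL n)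

/-- The diagonal matrix `diag(t^{ν 1}, …, t^{ν n})`. -/
noncomputable def tPow {n : ℕ} (ν : Fin n → ℤ) : GL (Fin n) ℂ⸨X⸩ where
  val := Matrix.diagonal fun i => HahnSeries.single (ν i) 1
  inv := Matrix.diagonal fun i => HahnSeries.single (-ν i) 1
  val_inv := by simp [Matrix.diagonal_mul_diagonal]
  inv_val := by simp [Matrix.diagonal_mul_diagonal]

/-- The point of `𝒢'` attached to a coweight `μ`. The sign is the one for which its stabilizer
is the parahoric subgroup containing the affine root subgroups `U_{(α, k)} = {1 + c t^k E_α}` with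
`(α, μ) + k ≥ 0`. -/
noncomputable def coweightPoint {n : ℕ} (μ : Fin n → ℤ) : AffineGrassmannian n :=
  AffineGrassmannian.ofGL (tPow (-μ))

/-! ### Parahoric subgroups of `G(𝒦) = SL_n(𝒦)` -/

/-- Helper: `A` satisfies the condition defining `parahoric μ` iff `A ∈ t^{-μ} SL_n(𝒪) t^{μ}`. -/
theorem parahoric_aux {n : ℕ} (μ : Fin n → ℤ) (A : SL(n, ℂ⸨X⸩)) :
    (∀ i j, ∀ k : ℤ, (A.1 i j).coeff k ≠ 0 → 0 ≤ μ i - μ j + k) ↔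
      ∃ B : SL(n, ℂ⟦X⟧), Matrix.SpecialLinearGroup.toGL A =
        tPow (-μ) * Matrix.SpecialLinearGroup.mapGL ℂ⸨X⸩ B * (tPow (-μ))⁻¹ := by
  have key : ∀ B : SL(n, ℂ⟦X⟧), (Matrix.SpecialLinearGroup.toGL A =
        tPow (-μ) * Matrix.SpecialLinearGroup.mapGL ℂ⸨X⸩ B * (tPow (-μ))⁻¹) ↔
        ∀ i j, ∀ k : ℤ, (A.1 i j).coeff k =
          (HahnSeries.ofPowerSeries ℤ ℂ (B.1 i j)).coeff (k + μ i - μ j) := by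
    intro B
    rw [Units.ext_iff, ← Matrix.ext_iff]
    have e : ∀ i j, ((tPow (-μ) * Matrix.SpecialLinearGroup.mapGL ℂ⸨X⸩ B * (tPow (-μ))⁻¹ :
        GL (Fin n) ℂ⸨X⸩).1) i j = HahnSeries.single (-μ i) 1 *
          HahnSeries.ofPowerSeries ℤ ℂ (B.1 i j) * HahnSeries.single (μ j) 1 := by
      intro i j
      change ((Matrix.diagonal (fun i => HahnSeries.single ((-μ) i) (1 : ℂ)) *
        (B.1.map (algebraMap ℂ⟦X⟧ ℂ⸨X⸩))) *
        Matrix.diagonal (fun i => HahnSeries.single (-(-μ) i) (1 : ℂ))) i j = _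
      rw [Matrix.mul_diagonal, Matrix.diagonal_mul]
      simp
    refine forall_congr' fun i => forall_congr' fun j => ?_
    rw [e, HahnSeries.ext_iff, funext_iff]
    refine forall_congr' fun k => ?_
    rw [HahnSeries.coeff_mul_single, HahnSeries.coeff_single_mul]
    have : k - μ j - -μ i = k + μ i - μ j := by ring
    rw [this]
    simp
  simp only [key]
  constructor
  · intro h
    let M : Matrix (Fin n) (Fin n) ℂ⟦X⟧ :=
      fun i j => PowerSeries.mk fun m => (A.1 i j).coeff (m - μ i + μ j)
    have hM : ∀ i j, ∀ k : ℤ, (A.1 i j).coeff k =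
          (HahnSeries.ofPowerSeries ℤ ℂ (M i j)).coeff (k + μ i - μ j) := by
      intro i j k
      rw [PowerSeries.coeff_coe]
      split_ifs with hk
      · by_contra hne
        have := h i j k hne
        omega
      · simp only [M, PowerSeries.coeff_mk]
        congr 1
        omega
    have hA : A.1 = Matrix.diagonal (fun i => HahnSeries.single (-μ i) (1 : ℂ)) *
        (M.map (algebraMap ℂ⟦X⟧ ℂ⸨X⸩)) *
        Matrix.diagonal (fun i => HahnSeries.single (μ i) (1 : ℂ)) := by
      ext i j k
      rw [Matrix.mul_diagonal, Matrix.diagonal_mul, HahnSeries.coeff_mul_single,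
        HahnSeries.coeff_single_mul, hM]
      have : k - μ j - -μ i = k + μ i - μ j := by ring
      rw [this]
      simp
    have hdet : M.det = 1 := by
      have h1 := A.2
      rw [hA, Matrix.det_mul, Matrix.det_mul, mul_right_comm, ← Matrix.det_mul,
        Matrix.diagonal_mul_diagonal] at h1
      have h2 : (M.map (algebraMap ℂ⟦X⟧ ℂ⸨X⸩)).det = 1 := by
        simpa using h1
      have h3 : algebraMap ℂ⟦X⟧ ℂ⸨X⸩ M.det = algebraMap ℂ⟦X⟧ ℂ⸨X⸩ 1 := by
        rw [RingHom.map_det, map_one]; exact h2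
      exact IsFractionRing.injective ℂ⟦X⟧ ℂ⸨X⸩ h3
    exact ⟨⟨M, hdet⟩, hM⟩
  · rintro ⟨B, hB⟩ i j k hk
    rw [hB, PowerSeries.coeff_coe] at hk
    by_contra hlt
    rw [if_pos (by omega)] at hk
    exact hk rfl

/-- The parahoric subgroup `𝒫_μ` of `SL_n(𝒦)`: every affine root `(ε_i - ε_j, k)` that occurs in a
matrix of `𝒫_μ` (as the coefficient of `t^k` in the entry `(i, j)`) satisfies
`μ ∈ H⁺_{ε_i - ε_j, k}`, that is `(ε_i - ε_j, μ) + k ≥ 0`. -/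
noncomputable def parahoric {n : ℕ} (μ : Fin n → ℤ) : Subgroup SL(n, ℂ⸨X⸩) where
  carrier := {A | ∀ i j, ∀ k : ℤ, (A.1 i j).coeff k ≠ 0 → 0 ≤ μ i - μ j + k}
  one_mem' := (parahoric_aux μ 1).2 ⟨1, by simp⟩
  mul_mem' {A A'} hA hA' := by
    obtain ⟨B, hB⟩ := (parahoric_aux μ A).1 hA
    obtain ⟨B', hB'⟩ := (parahoric_aux μ A').1 hA'
    exact (parahoric_aux μ _).2 ⟨B * B', by rw [map_mul, map_mul, hB, hB']; group⟩
  inv_mem' {A} hA := by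
    obtain ⟨B, hB⟩ := (parahoric_aux μ A).1 hA
    exact (parahoric_aux μ _).2 ⟨B⁻¹, by rw [map_inv, map_inv, hB]; group⟩

/-- The parahoric subgroup `𝒬` attached to the segment `[μ, ν]`: a half space `H⁺` contains
`[μ, ν]` iff it contains `μ` and `ν`. -/
noncomputable def segmentParahoric {n : ℕ} (μ ν : Fin n → ℤ) : Subgroup SL(n, ℂ⸨X⸩) :=
  parahoric μ ⊓ parahoric ν

/-- Helper: `𝒫_μ` fixes the point `μ` of `𝒢'`. -/
theorem parahoric_smul {n : ℕ} (μ : Fin n → ℤ) {A : SL(n, ℂ⸨X⸩)} (hA : A ∈ parahoric μ) :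
    Matrix.SpecialLinearGroup.toPGL A • coweightPoint μ = coweightPoint μ := by
  obtain ⟨B, hB⟩ := (parahoric_aux μ A).1 hA
  change (QuotientGroup.mk (Matrix.ProjGenLinGroup.mk (Matrix.SpecialLinearGroup.toGL A) *
    Matrix.ProjGenLinGroup.mk (tPow (-μ))) : PGL(n, ℂ⸨X⸩) ⧸ integralPoints n) =
      QuotientGroup.mk (Matrix.ProjGenLinGroup.mk (tPow (-μ)))
  rw [eq_comm, QuotientGroup.eq, hB]
  refine ⟨Matrix.SpecialLinearGroup.toGL B, ?_⟩
  rw [← map_mul, ← map_inv, ← map_mul]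
  have e : Matrix.GeneralLinearGroup.map (n := Fin n) (algebraMap ℂ⟦X⟧ ℂ⸨X⸩)
      (Matrix.SpecialLinearGroup.toGL B) = Matrix.SpecialLinearGroup.mapGL ℂ⸨X⸩ B :=
    Units.ext rfl
  rw [MonoidHom.comp_apply, e]
  congr 1
  group

/-! ### The Bott-Samelson variety of type `(1, …, 1)` with center a word `c` -/

/-- The product `𝒫_{μ_0} × 𝒫_{μ_1} × ⋯ × 𝒫_{μ_N}`, where `(μ_0, …, μ_N)` is the polyline of `c`. -/
structure ParahoricProduct {n : ℕ} (c : List (Fin n)) : Type where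
  /-- The tuple `(p_0, …, p_N)`. -/
  toFun : Fin (c.length + 1) → SL(n, ℂ⸨X⸩)
  mem : ∀ j : Fin (c.length + 1), toFun j ∈ parahoric (vertex c j)

/-- The classical topology on the product of the parahoric subgroups: the coarsest topology for
which all Laurent coefficients of all matrix entries are continuous functions with values
in `ℂ` (with its usual topology). -/
noncomputable instance {n : ℕ} (c : List (Fin n)) : TopologicalSpace (ParahoricProduct c) :=
  TopologicalSpace.induced
    (fun (p : ParahoricProduct c) (v : Fin (c.length + 1) × Fin n × Fin n × ℤ) =>
      ((p.1 v.1).1 v.2.1 v.2.2.1).coeff v.2.2.2) Pi.topologicalSpace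

/-- Two tuples define the same point of the Bott-Samelson variety iff they are in the same orbit of
`𝒬_0 × ⋯ × 𝒬_{N-1} × 𝒫_{μ_N}` acting by
`(q_0, …, q_N) ∘ (p_0, …, p_N) = (p_0 q_0, q_0⁻¹ p_1 q_1, …, q_{N-1}⁻¹ p_N q_N)`. -/
def bottSamelsonSetoid {n : ℕ} (c : List (Fin n)) : Setoid (ParahoricProduct c) where
  r p p' := ∃ q : Fin (c.length + 1) → SL(n, ℂ⸨X⸩),
    (∀ j : Fin c.length, q j.castSucc ∈ segmentParahoric (vertex c j) (vertex c (j + 1))) ∧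
    q (Fin.last _) ∈ parahoric (vertex c c.length) ∧
    p'.1 0 = p.1 0 * q 0 ∧
    ∀ j : Fin c.length, p'.1 j.succ = (q j.castSucc)⁻¹ * p.1 j.succ * q j.succ
  iseqv :=
    { refl := fun p => ⟨fun _ => 1, fun _ => one_mem _, one_mem _, by simp, by simp⟩
      symm := by
        rintro p p' ⟨q, hq, hl, h0, hs⟩
        refine ⟨fun j => (q j)⁻¹, fun j => inv_mem (hq j), inv_mem hl, ?_, fun j => ?_⟩
        · rw [h0]; group
        · rw [hs]; group
      trans := by
        rintro p p' p'' ⟨q, hq, hl, h0, hs⟩ ⟨q', hq', hl', h0', hs'⟩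
        refine ⟨fun j => q j * q' j, fun j => mul_mem (hq j) (hq' j), mul_mem hl hl', ?_,
          fun j => ?_⟩
        · rw [h0', h0]; group
        · rw [hs', hs]; group }

/-- The Bott-Samelson variety
`Σ = 𝒫_{μ_0} ×_{𝒬_0} 𝒫_{μ_1} ×_{𝒬_1} ⋯ ×_{𝒬_{N-1}} 𝒫_{μ_N} / 𝒫_{μ_N}` of type `(1, …, 1)`, with
center the word `c` of length `N`. -/
def BottSamelson {n : ℕ} (c : List (Fin n)) : Type := Quotient (bottSamelsonSetoid c)

/-- The classical topology of `Σ`: the quotient topology. -/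
noncomputable instance {n : ℕ} (c : List (Fin n)) : TopologicalSpace (BottSamelson c) :=
  inferInstanceAs (TopologicalSpace (Quotient (bottSamelsonSetoid c)))

namespace BottSamelson

/-- The map `Σ → 𝒢'`, `[p_0, …, p_N] ↦ p_0 ⋯ p_{j-1} μ_j`, for `0 ≤ j ≤ N`. -/
noncomputable def point {n : ℕ} {c : List (Fin n)} (j : Fin (c.length + 1)) :
    BottSamelson c → AffineGrassmannian n :=
  Quotient.lift
    (fun p : ParahoricProduct c =>
      Matrix.SpecialLinearGroup.toPGL (Fin.partialProd (fun i : Fin c.length => p.1 i.castSucc) j) •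
        coweightPoint (vertex c j))
    (by
      rintro p p' ⟨q, hq, hl, h0, hs⟩
      cases j using Fin.cases with
      | zero => simp
      | succ j =>
        have key : Fin.partialProd (fun i : Fin c.length => p'.1 i.castSucc) j.succ =
            Fin.partialProd (fun i : Fin c.length => p.1 i.castSucc) j.succ * q j.castSucc := by
          obtain ⟨j, hj⟩ := j
          induction j with
          | zero =>
            rw [Fin.partialProd_succ, Fin.partialProd_succ]
            have e : Fin.castSucc (⟨0, hj⟩ : Fin c.length) = 0 := rfl
            simp only [e, Fin.partialProd_zero, one_mul]
            exact h0
          | succ j ih =>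
            have ih := ih (by omega)
            rw [Fin.partialProd_succ, Fin.partialProd_succ]
            have e : Fin.castSucc (⟨j + 1, hj⟩ : Fin c.length) =
              Fin.succ (⟨j, by omega⟩ : Fin c.length) := rfl
            rw [e, ih, hs]
            group
        have hmem : q j.castSucc ∈ parahoric (vertex c ((j.succ : Fin (c.length + 1)) : ℕ)) :=
          (hq j).2
        rw [key, map_mul, mul_smul, parahoric_smul _ hmem])

/-- The map `π : Σ → 𝒢'`, `[p_0, …, p_N] ↦ p_0 ⋯ p_{N-1} μ_N`. -/
noncomputable def π {n : ℕ} (c : List (Fin n)) : BottSamelson c → AffineGrassmannian n :=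
  point (Fin.last c.length)

/-- The action of `g ∈ 𝒫_{μ_0} = SL_n(𝒪)` on `Σ`: `g [p_0, p_1, …, p_N] = [g p_0, p_1, …, p_N]`. -/
noncomputable def translate {n : ℕ} {c : List (Fin n)} (g : parahoric (vertex c 0)) :
    BottSamelson c → BottSamelson c :=
  Quotient.map
    (fun p : ParahoricProduct c => ⟨Function.update p.1 0 (g.1 * p.1 0), fun j => by
      by_cases hj : j = 0
      · subst hj
        simpa using mul_mem g.2 (p.2 0)
      · simpa [Function.update_of_ne hj] using p.2 j⟩)
    (by
      rintro p p' ⟨q, hq, hl, h0, hs⟩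
      refine ⟨q, hq, hl, ?_, fun j => ?_⟩
      · simp [h0, mul_assoc]
      · simpa using hs j)

end BottSamelson

/-! ### One-parameter subgroups and cells -/

/-- Helper: the matrix `diag(s^{a 1}, …, s^{a n})` has determinant `1` if `∑ a i = 0`. -/
theorem det_oneParameter {n : ℕ} (a : Fin n → ℤ) (ha : ∑ i, a i = 0) (s : ℂˣ) :
    (Matrix.diagonal fun i => HahnSeries.C ((s ^ a i : ℂˣ) : ℂ) :
      Matrix (Fin n) (Fin n) ℂ⸨X⸩).det = 1 := by
  have h : ∀ u : Finset (Fin n), ∏ i ∈ u, s ^ a i = s ^ (∑ i ∈ u, a i) := fun u => by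
    induction u using Finset.induction_on with
    | empty => rw [Finset.prod_empty, Finset.sum_empty, zpow_zero]
    | insert i u hi ih => rw [Finset.prod_insert hi, Finset.sum_insert hi, ih, zpow_add]
  rw [Matrix.det_diagonal, ← map_prod, ← Units.coe_prod, h, ha, zpow_zero, Units.val_one, map_one]

/-- The value at `s ∈ ℂˣ` of the one-parameter subgroup
`η : s ↦ diag(s^{a 1}, …, s^{a n})` of the torus `T ⊂ SL_n(ℂ)`, as an element of
`𝒫_{μ_0} = SL_n(𝒪) ⊂ SL_n(𝒦)`. -/
noncomputable def oneParameter {n : ℕ} (a : Fin n → ℤ) (ha : ∑ i, a i = 0) (c : List (Fin n))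
    (s : ℂˣ) : parahoric (vertex c 0) :=
  ⟨⟨Matrix.diagonal fun i => HahnSeries.C ((s ^ a i : ℂˣ) : ℂ), det_oneParameter a ha s⟩, by
    intro i j k hk
    change (Matrix.diagonal (fun i => HahnSeries.C ((s ^ a i : ℂˣ) : ℂ)) i j).coeff k ≠ 0 at hk
    by_cases hij : i = j
    · subst hij
      by_cases h0 : k = 0
      · rw [h0, sub_self, add_zero]
      · refine absurd ?_ hk
        rw [Matrix.diagonal_apply_eq, HahnSeries.C_apply, HahnSeries.coeff_single_of_ne h0]
    · refine absurd ?_ hk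
      rw [Matrix.diagonal_apply_ne _ hij, HahnSeries.coeff_zero]⟩

/-- `y ∈ Σ` is the torus fixed point that corresponds to the word `w` (of the same length as the
center `c`): it is mapped to the vertices of the polyline of `w`. In terms of parahoric subgroups,
`p_0 ⋯ p_{j-1} 𝒫_{μ_j(c)} (p_0 ⋯ p_{j-1})⁻¹ = 𝒫_{μ_j(w)}` for all `j`. -/
def IsFixedPointOf {n : ℕ} {c : List (Fin n)} (w : List (Fin n)) (y : BottSamelson c) : Prop :=
  ∀ j : Fin (c.length + 1), y.point j = coweightPoint (vertex w j)

/-- The Białynicki-Birula cell `C_w = {x ∈ Σ | lim_{s → 0} η(s) x = y_w}`, where `y_w` is the fixed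
point of `w` and `η(s) = diag(s^{a 1}, …, s^{a n})`. -/
def cell {n : ℕ} (a : Fin n → ℤ) (ha : ∑ i, a i = 0) (c w : List (Fin n)) :
    Set (BottSamelson c) :=
  {x | ∃ y : BottSamelson c, IsFixedPointOf w y ∧
    Filter.Tendsto (fun s : ℂˣ => BottSamelson.translate (oneParameter a ha c s) x)
      (Filter.comap Units.val (𝓝 (0 : ℂ))) (𝓝 y)}

end KnuthMV


/-!
For a word `w` of the same length as the center, the cell of `w` is parametrized by products
of elementary steps `(1 + ∑_{l > i} b_l E_{l i}) t^{-ε_i}`, where `i` runs through the letters of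
`w`: these are coordinates of `Σ` around the fixed point of `w` in which `η` acts diagonally, and a
coordinate contracts to `0` exactly if it lies below the diagonal. Hence the image of the cell under
`π` consists of the classes of all products of lower triangular steps along `w`.

Up to a lower unipotent factor on the right, every product of such steps along `xz` with `x < z` is
one along `zx`. Conversely, in presence of the third letter `y` of the Knuth relation, a product
along `zxy` (or `yzx`) is one along `xzy` (or `yxz`) as soon as a single parameter does not vanish.
This parameter is made nonzero by moving along a line, and a Zariski closed set containing
infinitely many points of a line contains all of it.
-/

namespace KnuthMV

open Matrix Matrix.SpecialLinearGroup
open scoped Pointwise PowerSeries.WithPiTopology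

section Shear

variable {ι R S : Type*} [Fintype ι] [DecidableEq ι] [CommRing R] [CommRing S]

/-- The matrix `1 + ∑_{l ≠ i} b_l E_{l i}`. The entry `b i` is ignored. -/
def shear (i : ι) (b : ι → R) : SpecialLinearGroup ι R :=
  ⟨1 + vecMulVec (Function.update b i 0) (Pi.single i 1), by
    rw [vecMulVec_eq Unit, det_one_add_replicateCol_mul_replicateRow]
    simp⟩

theorem shear_mulVec (i : ι) (b v : ι → R) :
    (shear i b).1 *ᵥ v = v + v i • Function.update b i 0 := by
  simp [shear, add_mulVec, vecMulVec_mulVec]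

theorem shear_mulVec_of_apply_eq_zero {i : ι} {b : ι → R} (hb : b i = 0) (v : ι → R) :
    (shear i b).1 *ᵥ v = v + v i • b := by
  rw [shear_mulVec, Function.update_eq_self_iff.2 hb.symm]

theorem shear_apply_self (i : ι) (b : ι → R) {l : ι} (h : l ≠ i) : (shear i b).1 l i = b l := by
  simp [shear, vecMulVec_apply, h]

theorem shear_apply_ne (i : ι) (b : ι → R) {l m : ι} (h : m ≠ i) :
    (shear i b).1 l m = (1 : Matrix ι ι R) l m := by
  simp [shear, vecMulVec_apply, h]

theorem shear_apply_diag (i : ι) (b : ι → R) (l : ι) : (shear i b).1 l l = 1 := by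
  obtain rfl | h := eq_or_ne l i
  · simp [shear, vecMulVec_apply]
  · simp [shear_apply_ne i b h]

@[simp]
theorem shear_zero (i : ι) : shear i (0 : ι → R) = 1 :=
  Subtype.ext (by simp [shear])

theorem shear_add (i : ι) (b b' : ι → R) : shear i (b + b') = shear i b * shear i b' := by
  refine Subtype.ext (Matrix.ext_of_mulVec_single fun m => ?_)
  rw [coe_mul, ← mulVec_mulVec]
  ext l
  simp only [shear_mulVec]
  obtain rfl | h := eq_or_ne l i
  · simp
  · simp [h]
    ring

theorem shear_neg (i : ι) (b : ι → R) : shear i (-b) = (shear i b)⁻¹ := by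
  rw [eq_inv_iff_mul_eq_one, ← shear_add, neg_add_cancel, shear_zero]

theorem map_shear (f : R →+* S) (i : ι) (b : ι → R) :
    SpecialLinearGroup.map f (shear i b) = shear i (f ∘ b) := by
  ext l m
  obtain rfl | hm := eq_or_ne m i
  · obtain rfl | hl := eq_or_ne l m
    · simp [shear_apply_diag]
    · simp [shear_apply_self _ _ hl]
  · simp [shear_apply_ne _ _ hm, Matrix.one_apply, apply_ite f]

theorem shear_mul_apply (i : ι) (b : ι → R) (M : Matrix ι ι R) (l m : ι) :
    ((shear i b).1 * M) l m = M l m + M i m * Function.update b i 0 l :=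
  congrFun (shear_mulVec i b fun k => M k m) l

theorem mul_shear {M : Matrix ι ι R} {i j : ι} {u : R} {d d' : ι → R}
    (hrow : ∀ v, (M *ᵥ v) j = u * v i) (hd : M *ᵥ d = u • d') (hi : d i = 0) (hj : d' j = 0) :
    M * (shear i d).1 = (shear j d').1 * M := by
  refine Matrix.ext_of_mulVec_single fun m => ?_
  rw [← mulVec_mulVec, ← mulVec_mulVec, shear_mulVec_of_apply_eq_zero hi,
    shear_mulVec_of_apply_eq_zero hj, mulVec_add, mulVec_smul, hd, hrow, smul_smul, mul_comm]

end Shear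

section LowerUnipotent

variable {ι R : Type*} [Fintype ι] [LinearOrder ι] [CommRing R]

/-- The lower triangular matrices with ones on the diagonal. -/
def lowerUnipotent (ι R : Type*) [Fintype ι] [LinearOrder ι] [CommRing R] :
    Submonoid (SpecialLinearGroup ι R) where
  carrier := {A | (∀ l, A.1 l l = 1) ∧ ∀ l m, l < m → A.1 l m = 0}
  one_mem' := ⟨by simp, fun l m h => by simp [h.ne]⟩
  mul_mem' {A B} hA hB := by
    refine ⟨fun l => ?_, fun l m hlm => ?_⟩
    · rw [coe_mul, Matrix.mul_apply, Finset.sum_eq_single l, hA.1, hB.1, mul_one]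
      · intro k _ hk
        rcases lt_or_gt_of_ne hk with h | h
        · rw [hB.2 _ _ h, mul_zero]
        · rw [hA.2 _ _ h, zero_mul]
      · simp
    · rw [coe_mul, Matrix.mul_apply]
      refine Finset.sum_eq_zero fun k _ => ?_
      rcases lt_or_ge l k with h | h
      · rw [hA.2 _ _ h, zero_mul]
      · rw [hB.2 _ _ (h.trans_lt hlm), mul_zero]

theorem shear_mem_lowerUnipotent {i : ι} {b : ι → R} (hb : ∀ l < i, b l = 0) :
    shear i b ∈ lowerUnipotent ι R := by
  refine ⟨shear_apply_diag i b, fun l m hlm => ?_⟩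
  obtain rfl | hm := eq_or_ne m i
  · rw [shear_apply_self _ _ hlm.ne, hb l hlm]
  · rw [shear_apply_ne _ _ hm, Matrix.one_apply_ne hlm.ne]

end LowerUnipotent

section Laurent

variable {n : ℕ}

theorem mapGL_apply (A : SL(n, ℂ⟦X⟧)) (l m : Fin n) :
    (mapGL ℂ⸨X⸩ A).1 l m = HahnSeries.ofPowerSeries ℤ ℂ (A.1 l m) := by
  simp

theorem tPow_zero : tPow (0 : Fin n → ℤ) = 1 :=
  Units.ext (by simp [tPow])

theorem tPow_add (μ ν : Fin n → ℤ) : tPow (μ + ν) = tPow μ * tPow ν :=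
  Units.ext (by simp [tPow, diagonal_mul_diagonal])

theorem tPow_neg (μ : Fin n → ℤ) : tPow (-μ) = (tPow μ)⁻¹ := by
  rw [eq_inv_iff_mul_eq_one, ← tPow_add, neg_add_cancel, tPow_zero]

theorem tPow_mulVec (μ : Fin n → ℤ) (v : Fin n → ℂ⸨X⸩) (l : Fin n) :
    ((tPow μ).1 *ᵥ v) l = HahnSeries.single (μ l) 1 * v l := by
  simp [tPow, mulVec_diagonal]

/-- The shear of `SL_n(ℂ) ⊆ SL_n(𝒪)` with parameters `b`. -/
noncomputable def constShear (i : Fin n) (b : Fin n → ℂ) : SL(n, ℂ⟦X⟧) :=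
  shear i (PowerSeries.C ∘ b)

@[simp]
theorem constShear_zero (i : Fin n) : constShear i 0 = 1 := by
  rw [constShear, show PowerSeries.C ∘ (0 : Fin n → ℂ) = 0 from funext fun _ => map_zero _,
    shear_zero]

theorem constShear_add (i : Fin n) (b b' : Fin n → ℂ) :
    constShear i (b + b') = constShear i b * constShear i b' := by
  rw [constShear, constShear, constShear, ← shear_add]
  exact congrArg _ (funext fun _ => map_add _ _ _)

theorem constShear_neg (i : Fin n) (b : Fin n → ℂ) : constShear i (-b) = (constShear i b)⁻¹ := by
  rw [constShear, constShear, ← shear_neg]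
  exact congrArg _ (funext fun _ => map_neg _ _)

theorem constShear_mem_lowerUnipotent {i : Fin n} {b : Fin n → ℂ} (hb : ∀ l ≤ i, b l = 0) :
    constShear i b ∈ lowerUnipotent (Fin n) ℂ⟦X⟧ :=
  shear_mem_lowerUnipotent fun l hl => by simp [hb l hl.le]

theorem mapGL_constShear_val (i : Fin n) (b : Fin n → ℂ) :
    (mapGL ℂ⸨X⸩ (constShear i b)).1 = (shear i (HahnSeries.C (Γ := ℤ) ∘ b)).1 := by
  rw [mapGL_coe_matrix, constShear, map_shear]
  exact congrArg (fun d => (shear i d).1) (funext fun l => HahnSeries.ofPowerSeries_C (b l))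

theorem mapGL_constShear_mulVec {i : Fin n} {b : Fin n → ℂ} (hb : b i = 0) (v : Fin n → ℂ⸨X⸩)
    (l : Fin n) :
    ((mapGL ℂ⸨X⸩ (constShear i b)).1 *ᵥ v) l = v l + v i * HahnSeries.C (b l) := by
  rw [mapGL_constShear_val, shear_mulVec_of_apply_eq_zero (by simp [hb])]
  rfl

theorem mul_mapGL_constShear {g : GL (Fin n) ℂ⸨X⸩} {i j : Fin n} {u : ℂ⸨X⸩} {b b' : Fin n → ℂ}
    (hrow : ∀ v, (g.1 *ᵥ v) j = u * v i)
    (hcol : ∀ l, (g.1 *ᵥ (HahnSeries.C ∘ b)) l = u * HahnSeries.C (b' l))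
    (hi : b i = 0) (hj : b' j = 0) :
    g * mapGL ℂ⸨X⸩ (constShear i b) = mapGL ℂ⸨X⸩ (constShear j b') * g := by
  refine Units.ext ?_
  rw [Units.val_mul, Units.val_mul, mapGL_constShear_val, mapGL_constShear_val]
  exact mul_shear hrow (funext hcol) (by simp [hi]) (by simp [hj])

end Laurent

section ParahoricConj

variable {n : ℕ}

/-- The isomorphism `B ↦ t^{-μ} B t^μ` from `SL_n(𝒪)` onto the parahoric subgroup of `μ`. -/
noncomputable def parahoricConj (μ : Fin n → ℤ) : SL(n, ℂ⟦X⟧) →* SL(n, ℂ⸨X⸩) where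
  toFun B := ⟨(tPow (-μ) * mapGL ℂ⸨X⸩ B * (tPow (-μ))⁻¹).1, by
    have h : (tPow (-μ) * mapGL ℂ⸨X⸩ B * (tPow (-μ))⁻¹).det = 1 := by
      rw [map_mul, map_mul, map_inv, det_mapGL, mul_one, mul_inv_cancel]
    exact congrArg Units.val h⟩
  map_one' := Subtype.ext (by simp)
  map_mul' B B' := toGL_injective <| Units.ext <| by
    change (tPow (-μ) * mapGL ℂ⸨X⸩ (B * B') * (tPow (-μ))⁻¹).1 =
      ((tPow (-μ) * mapGL ℂ⸨X⸩ B * (tPow (-μ))⁻¹) *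
        (tPow (-μ) * mapGL ℂ⸨X⸩ B' * (tPow (-μ))⁻¹)).1
    rw [map_mul]
    group

theorem toGL_parahoricConj (μ : Fin n → ℤ) (B : SL(n, ℂ⟦X⟧)) :
    toGL (parahoricConj μ B) = tPow (-μ) * mapGL ℂ⸨X⸩ B * (tPow (-μ))⁻¹ :=
  Units.ext rfl

theorem range_parahoricConj (μ : Fin n → ℤ) : (parahoricConj μ).range = parahoric μ := by
  ext A
  refine Iff.trans ?_ (parahoric_aux μ A).symm
  simp only [MonoidHom.mem_range, ← toGL_parahoricConj, toGL_injective.eq_iff, eq_comm]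

theorem coeff_parahoricConj (μ : Fin n → ℤ) (B : SL(n, ℂ⟦X⟧)) (l m : Fin n) (k : ℤ) :
    ((parahoricConj μ B).1 l m).coeff k =
      (HahnSeries.ofPowerSeries ℤ ℂ (B.1 l m)).coeff (k + μ l - μ m) := by
  have hentry : (parahoricConj μ B).1 l m = HahnSeries.single (-μ l) 1 *
      HahnSeries.ofPowerSeries ℤ ℂ (B.1 l m) * HahnSeries.single (μ m) 1 := by
    change (diagonal (fun i => HahnSeries.single ((-μ) i) (1 : ℂ)) * (mapGL ℂ⸨X⸩ B).1 *
        diagonal (fun i => HahnSeries.single (-(-μ) i) (1 : ℂ))) l m = _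
    rw [mul_diagonal, diagonal_mul, mapGL_apply, Pi.neg_apply, Pi.neg_apply, neg_neg]
  rw [hentry, HahnSeries.coeff_mul_single, HahnSeries.coeff_single_mul, one_mul, mul_one]
  congr 1
  ring

theorem parahoricConj_zero (B : SL(n, ℂ⟦X⟧)) :
    parahoricConj 0 B = SpecialLinearGroup.map (algebraMap ℂ⟦X⟧ ℂ⸨X⸩) B :=
  toGL_injective <| by
    rw [toGL_parahoricConj, neg_zero, tPow_zero, one_mul, inv_one, mul_one]
    rfl

theorem parahoricConj_eq_parahoricConj_iff {μ ν : Fin n → ℤ} {Y h : SL(n, ℂ⟦X⟧)} :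
    parahoricConj μ Y = parahoricConj ν h ↔
      mapGL ℂ⸨X⸩ Y * tPow (μ - ν) = tPow (μ - ν) * mapGL ℂ⸨X⸩ h := by
  rw [← toGL_injective.eq_iff, toGL_parahoricConj, toGL_parahoricConj, sub_eq_add_neg, tPow_add,
    tPow_neg μ, inv_inv, eq_mul_inv_iff_mul_eq, mul_assoc, mul_assoc, inv_mul_eq_iff_eq_mul,
    ← mul_assoc (tPow μ)]

theorem mul_tPow_neg_eq_iff {μ : Fin n → ℤ} {Y h : SL(n, ℂ⟦X⟧)} :
    mapGL ℂ⸨X⸩ Y * tPow (-μ) = tPow (-μ) * mapGL ℂ⸨X⸩ h ↔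
      SpecialLinearGroup.map (algebraMap ℂ⟦X⟧ ℂ⸨X⸩) Y = parahoricConj μ h := by
  rw [← parahoricConj_zero, parahoricConj_eq_parahoricConj_iff, zero_sub]

theorem map_mem_parahoric_single_iff {i : Fin n} {Y : SL(n, ℂ⟦X⟧)} :
    SpecialLinearGroup.map (algebraMap ℂ⟦X⟧ ℂ⸨X⸩) Y ∈ parahoric (Pi.single i 1) ↔
      ∀ l ≠ i, PowerSeries.constantCoeff (Y.1 l i) = 0 := by
  change (∀ l m, ∀ k : ℤ, (HahnSeries.ofPowerSeries ℤ ℂ (Y.1 l m)).coeff k ≠ 0 → _) ↔ _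
  simp only [PowerSeries.coeff_coe]
  refine ⟨fun h l hl => ?_, fun h l m k hk => ?_⟩
  · by_contra h0
    simpa [hl] using h l i 0 (by simpa using h0)
  · rw [ne_eq, ite_eq_left_iff, not_forall] at hk
    obtain ⟨hk0, hk⟩ := hk
    by_cases hlm : m = i ∧ l ≠ i ∧ k = 0
    · obtain ⟨rfl, hl, rfl⟩ := hlm
      exact absurd (by simpa using h l hl) hk
    · simp only [Pi.single_apply]
      split_ifs <;> grind

end ParahoricConj

section ElementaryStep

variable {n : ℕ}

/-- The matrix `(1 + ∑_{l ≠ i} b_l E_{l i}) t^{-ε_i}`, whose class in `𝒢'` is a neighbour of the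
base point. -/
noncomputable def elementaryStep (i : Fin n) (b : Fin n → ℂ) : GL (Fin n) ℂ⸨X⸩ :=
  mapGL ℂ⸨X⸩ (constShear i b) * tPow (-Pi.single i 1)

theorem elementaryStep_add (i : Fin n) (b b' : Fin n → ℂ) :
    elementaryStep i (b + b') = mapGL ℂ⸨X⸩ (constShear i b) * elementaryStep i b' := by
  rw [elementaryStep, elementaryStep, constShear_add, map_mul, mul_assoc]

theorem elementaryStep_mulVec_self (i : Fin n) (b : Fin n → ℂ) (v : Fin n → ℂ⸨X⸩) :
    ((elementaryStep i b).1 *ᵥ v) i = HahnSeries.single (-1) 1 * v i := by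
  rw [elementaryStep, Units.val_mul, ← mulVec_mulVec, mapGL_constShear_val, shear_mulVec]
  simp [tPow_mulVec]

theorem elementaryStep_mulVec_of_ne {i l : Fin n} (h : l ≠ i) (b : Fin n → ℂ)
    (v : Fin n → ℂ⸨X⸩) :
    ((elementaryStep i b).1 *ᵥ v) l =
      v l + HahnSeries.single (-1) 1 * v i * HahnSeries.C (b l) := by
  rw [elementaryStep, Units.val_mul, ← mulVec_mulVec, mapGL_constShear_val, shear_mulVec]
  simp [tPow_mulVec, h]

/-- The shift of the coefficients is the conjugation with `t^{ε_i}`. -/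
theorem exists_mul_tPow_eq_elementaryStep_mul {i : Fin n} {b : Fin n → ℂ} {Y : SL(n, ℂ⟦X⟧)}
    (hY : ∀ l ≠ i, PowerSeries.constantCoeff (Y.1 l i) =
      PowerSeries.constantCoeff (Y.1 i i) * b l) :
    ∃ h : SL(n, ℂ⟦X⟧), mapGL ℂ⸨X⸩ Y * tPow (-Pi.single i 1) = elementaryStep i b * mapGL ℂ⸨X⸩ h ∧
      ∀ l m (k : ℤ), (HahnSeries.ofPowerSeries ℤ ℂ (h.1 l m)).coeff k =
        (HahnSeries.ofPowerSeries ℤ ℂ ((constShear i (-b) * Y).1 l m)).coeff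
          (k - Pi.single (M := fun _ => ℤ) i 1 l + Pi.single (M := fun _ => ℤ) i 1 m) := by
  have hmem : SpecialLinearGroup.map (algebraMap ℂ⟦X⟧ ℂ⸨X⸩) (constShear i (-b) * Y) ∈
      (parahoricConj (Pi.single i 1)).range := by
    rw [range_parahoricConj, map_mem_parahoric_single_iff]
    intro l hl
    simp [constShear, shear_mul_apply, hl, hY l hl]
  obtain ⟨h, hh⟩ := hmem
  refine ⟨h, ?_, fun l m k => ?_⟩
  · rw [elementaryStep, mul_assoc, ← mul_tPow_neg_eq_iff.2 hh.symm, ← mul_assoc, ← map_mul,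
      constShear_neg, mul_inv_cancel_left]
  · have hcoeff := coeff_parahoricConj (Pi.single i 1) h l m
      (k - Pi.single (M := fun _ => ℤ) i 1 l + Pi.single (M := fun _ => ℤ) i 1 m)
    rw [hh] at hcoeff
    exact (congrArg _ (by ring)).trans hcoeff.symm

theorem eq_of_elementaryStep_eq {i : Fin n} {b b' : Fin n → ℂ} {h : SL(n, ℂ⟦X⟧)}
    (H : elementaryStep i b = elementaryStep i b' * mapGL ℂ⸨X⸩ h) {l : Fin n} (hl : l ≠ i) :
    b l = b' l := by
  have hconj : mapGL ℂ⸨X⸩ (constShear i (-b' + b)) * tPow (-Pi.single i 1) =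
      tPow (-Pi.single i 1) * mapGL ℂ⸨X⸩ h := by
    rw [constShear_add, map_mul, mul_assoc, ← elementaryStep, H, elementaryStep, constShear_neg,
      map_inv, mul_assoc, inv_mul_cancel_left]
  have hmem := mul_tPow_neg_eq_iff.1 hconj ▸ (range_parahoricConj (Pi.single i 1)).le ⟨h, rfl⟩
  have hzero := map_mem_parahoric_single_iff.1 hmem l hl
  rw [constShear, shear_apply_self _ _ hl] at hzero
  simpa [add_eq_zero_iff_eq_neg, eq_comm] using hzero

theorem commute_tPow_mapGL_constShear {x z : Fin n} (hxz : x ≠ z) {b : Fin n → ℂ} (hbz : b z = 0)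
    (hbx : b x = 0) : Commute (tPow (-Pi.single x 1)) (mapGL ℂ⸨X⸩ (constShear z b)) := by
  refine mul_mapGL_constShear (u := 1) (fun v => ?_) (fun l => ?_) hbz hbz
  · simp [tPow_mulVec, hxz.symm]
  · obtain rfl | hl := eq_or_ne l x
    · simp [tPow_mulVec, hbx]
    · simp [tPow_mulVec, hl]

theorem commute_elementaryStep {x z : Fin n} (hxz : x ≠ z) {b b' : Fin n → ℂ} (hbx : b x = 0)
    (hbz : b z = 0) (hbx' : b' x = 0) (hbz' : b' z = 0) :
    Commute (elementaryStep z b) (elementaryStep x b') := by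
  have hstep : elementaryStep z b * mapGL ℂ⸨X⸩ (constShear x b') =
      mapGL ℂ⸨X⸩ (constShear x b') * elementaryStep z b := by
    refine mul_mapGL_constShear (u := 1) (fun v => ?_) (fun l => ?_) hbx' hbx'
    · simp [elementaryStep_mulVec_of_ne hxz, hbx]
    · obtain rfl | hl := eq_or_ne l z
      · simp [elementaryStep_mulVec_self, hbz']
      · simp [elementaryStep_mulVec_of_ne hl, hbz']
  calc elementaryStep z b * elementaryStep x b'
      = mapGL ℂ⸨X⸩ (constShear x b') * (mapGL ℂ⸨X⸩ (constShear z b) *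
          (tPow (-Pi.single z 1) * tPow (-Pi.single x 1))) := by
        rw [elementaryStep.eq_def x, ← mul_assoc, hstep, elementaryStep]
        simp only [mul_assoc]
    _ = elementaryStep x b' * elementaryStep z b := by
        rw [← tPow_add, add_comm, tPow_add, ← mul_assoc (mapGL ℂ⸨X⸩ (constShear z b)),
          ← (commute_tPow_mapGL_constShear hxz hbz hbx).eq]
        simp only [elementaryStep, mul_assoc]

/-- The last factor is integral, so the class of the product in `𝒢'` depends on the parameters of
the first step only modulo `e_y + b'`. -/
theorem elementaryStep_add_smul_mul {x y : Fin n} (hxy : x ≠ y) (b : Fin n → ℂ) {b' : Fin n → ℂ}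
    (hbx' : b' x = 0) (hby' : b' y = 0) (r : ℂ) :
    elementaryStep x (b + r • (Pi.single y 1 + b')) * elementaryStep y b' =
      elementaryStep x b * elementaryStep y b' * mapGL ℂ⸨X⸩ (constShear x (Pi.single y r)) := by
  set g := tPow (-Pi.single x 1) * elementaryStep y b' with hg
  have hslide : g * mapGL ℂ⸨X⸩ (constShear x (Pi.single y r)) =
      mapGL ℂ⸨X⸩ (constShear x (r • (Pi.single y 1 + b'))) * g := by
    refine mul_mapGL_constShear (u := HahnSeries.single (-1) 1) (fun v => ?_) (fun l => ?_)
      (by simp [hxy]) (by simp [hxy, hbx'])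
    · rw [hg, Units.val_mul, ← mulVec_mulVec, tPow_mulVec, elementaryStep_mulVec_of_ne hxy]
      simp [hbx']
    · rw [hg, Units.val_mul, ← mulVec_mulVec, tPow_mulVec]
      obtain rfl | hly := eq_or_ne l y
      · simp [elementaryStep_mulVec_self, hxy.symm, hby']
      · obtain rfl | hlx := eq_or_ne l x
        · simp [elementaryStep_mulVec_of_ne hly, hly, hbx']
        · simp [elementaryStep_mulVec_of_ne hly, hly, hlx]
  calc elementaryStep x (b + r • (Pi.single y 1 + b')) * elementaryStep y b'
      = mapGL ℂ⸨X⸩ (constShear x b) *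
          (mapGL ℂ⸨X⸩ (constShear x (r • (Pi.single y 1 + b'))) * g) := by
        rw [elementaryStep_add, elementaryStep.eq_def x (r • _), hg]
        simp only [mul_assoc]
    _ = elementaryStep x b * elementaryStep y b' * mapGL ℂ⸨X⸩ (constShear x (Pi.single y r)) := by
        rw [← hslide, hg, elementaryStep.eq_def x b]
        simp only [mul_assoc]

end ElementaryStep

section LowerProducts

variable {n : ℕ}

/-- The lower unipotent matrices with entries in `𝒪`, as a submonoid of `GL_n(𝒦)`. -/
noncomputable def integralLowerUnipotent (n : ℕ) : Submonoid (GL (Fin n) ℂ⸨X⸩) :=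
  (lowerUnipotent (Fin n) ℂ⟦X⟧).map (mapGL ℂ⸨X⸩)

/-- The elementary steps of type `i` with a lower triangular matrix. -/
def lowerSteps (i : Fin n) : Set (GL (Fin n) ℂ⸨X⸩) :=
  elementaryStep i '' {b | ∀ l ≤ i, b l = 0}

/-- The products of lower triangular elementary steps whose types are the letters of `w`. -/
def lowerProducts (w : List (Fin n)) : Set (GL (Fin n) ℂ⸨X⸩) := (w.map lowerSteps).prod

theorem elementaryStep_mem_lowerSteps {i : Fin n} {b : Fin n → ℂ} (hb : ∀ l ≤ i, b l = 0) :
    elementaryStep i b ∈ lowerSteps i :=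
  ⟨b, hb, rfl⟩

theorem lowerProducts_cons (i : Fin n) (w : List (Fin n)) :
    lowerProducts (i :: w) = lowerSteps i * lowerProducts w := by
  simp [lowerProducts]

theorem lowerProducts_append (v w : List (Fin n)) :
    lowerProducts (v ++ w) = lowerProducts v * lowerProducts w := by
  simp [lowerProducts]

theorem mapGL_constShear_mem_integralLowerUnipotent {i : Fin n} {b : Fin n → ℂ}
    (hb : ∀ l ≤ i, b l = 0) : mapGL ℂ⸨X⸩ (constShear i b) ∈ integralLowerUnipotent n :=
  ⟨_, constShear_mem_lowerUnipotent hb, rfl⟩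

theorem integralLowerUnipotent_mul_lowerSteps (i : Fin n) :
    (integralLowerUnipotent n : Set (GL (Fin n) ℂ⸨X⸩)) * lowerSteps i ⊆
      lowerSteps i * integralLowerUnipotent n := by
  rintro _ ⟨_, ⟨A, hA, rfl⟩, _, ⟨b, hb, rfl⟩, rfl⟩
  obtain ⟨hBdiag, hBlower⟩ := mul_mem hA (constShear_mem_lowerUnipotent hb)
  set B := A * constShear i b with hB
  set b' : Fin n → ℂ := fun l => if l ≤ i then 0 else PowerSeries.constantCoeff (B.1 l i)
  have hb' : ∀ l ≤ i, b' l = 0 := fun l hl => if_pos hl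
  have hcol : ∀ l ≠ i, PowerSeries.constantCoeff (B.1 l i) =
      PowerSeries.constantCoeff (B.1 i i) * b' l := by
    intro l hl
    rw [hBdiag, map_one, one_mul]
    rcases lt_or_gt_of_ne hl with h | h
    · rw [hBlower _ _ h, hb' l h.le, map_zero]
    · exact (if_neg h.not_ge).symm
  obtain ⟨h, hBh, hcoeff⟩ := exists_mul_tPow_eq_elementaryStep_mul hcol
  obtain ⟨hdiag, hlower⟩ :=
    mul_mem (constShear_mem_lowerUnipotent (b := -b') fun l hl => neg_eq_zero.2 (hb' l hl))
      ⟨hBdiag, hBlower⟩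
  have hh : h ∈ lowerUnipotent (Fin n) ℂ⟦X⟧ := by
    refine ⟨fun l => ?_, fun l m hlm => ?_⟩ <;>
      refine HahnSeries.ofPowerSeries_injective (Γ := ℤ) (HahnSeries.ext (funext fun k => ?_))
    · rw [hcoeff, hdiag, sub_add_cancel]
    · rw [hcoeff, hlower l m hlm, map_zero, HahnSeries.coeff_zero, HahnSeries.coeff_zero]
  refine ⟨_, ⟨b', hb', rfl⟩, _, ⟨h, hh, rfl⟩, ?_⟩
  change elementaryStep i b' * mapGL ℂ⸨X⸩ h = mapGL ℂ⸨X⸩ A * elementaryStep i b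
  rw [← hBh, hB, map_mul, mul_assoc, elementaryStep]

theorem integralLowerUnipotent_mul_lowerProducts (w : List (Fin n)) :
    (integralLowerUnipotent n : Set (GL (Fin n) ℂ⸨X⸩)) * lowerProducts w ⊆
      lowerProducts w * integralLowerUnipotent n := by
  induction w with
  | nil => simp [lowerProducts]
  | cons i w ih =>
    calc (integralLowerUnipotent n : Set (GL (Fin n) ℂ⸨X⸩)) * lowerProducts (i :: w)
        = integralLowerUnipotent n * lowerSteps i * lowerProducts w := by
          rw [lowerProducts_cons, mul_assoc]
      _ ⊆ lowerSteps i * integralLowerUnipotent n * lowerProducts w :=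
          Set.mul_subset_mul_right (integralLowerUnipotent_mul_lowerSteps i)
      _ ⊆ lowerProducts (i :: w) * integralLowerUnipotent n := by
          rw [lowerProducts_cons, mul_assoc, mul_assoc]
          exact Set.mul_subset_mul_left ih

/-- The products of lower triangular elementary steps along `w`, up to a lower unipotent factor
with entries in `𝒪`, which does not affect the class in `𝒢'`. -/
def lowerCosets (w : List (Fin n)) : Set (GL (Fin n) ℂ⸨X⸩) :=
  lowerProducts w * integralLowerUnipotent n

theorem lowerCosets_mul_lowerCosets (v w : List (Fin n)) :
    lowerCosets v * lowerCosets w ⊆ lowerCosets (v ++ w) :=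
  calc lowerCosets v * lowerCosets w
      = lowerProducts v * (integralLowerUnipotent n * lowerProducts w) *
          integralLowerUnipotent n := by
        simp only [lowerCosets, mul_assoc]
    _ ⊆ lowerProducts v * (lowerProducts w * integralLowerUnipotent n) *
          integralLowerUnipotent n :=
        Set.mul_subset_mul_right
          (Set.mul_subset_mul_left (integralLowerUnipotent_mul_lowerProducts w))
    _ = lowerCosets (v ++ w) := by
        rw [lowerCosets, lowerProducts_append]
        simp only [mul_assoc, coe_mul_coe]

theorem lowerProducts_subset_lowerCosets (w : List (Fin n)) : lowerProducts w ⊆ lowerCosets w :=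
  fun g hg => ⟨g, hg, 1, one_mem _, mul_one g⟩

theorem elementaryStep_mul_mem_lowerCosets {x y : Fin n} {b b' : Fin n → ℂ}
    {A : GL (Fin n) ℂ⸨X⸩} (hb : ∀ l ≤ x, b l = 0) (hb' : ∀ l ≤ y, b' l = 0)
    (hA : A ∈ integralLowerUnipotent n) :
    elementaryStep x b * elementaryStep y b' * A ∈ lowerCosets [x, y] := by
  refine ⟨_, ?_, A, hA, rfl⟩
  simpa [lowerProducts] using
    Set.mul_mem_mul (elementaryStep_mem_lowerSteps hb) (elementaryStep_mem_lowerSteps hb')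

theorem elementaryStep_mul_mem_lowerCosets_three {x y z : Fin n} {b b' b'' : Fin n → ℂ}
    {A : GL (Fin n) ℂ⸨X⸩} (hb : ∀ l ≤ x, b l = 0) (hb' : ∀ l ≤ y, b' l = 0)
    (hb'' : ∀ l ≤ z, b'' l = 0) (hA : A ∈ integralLowerUnipotent n) :
    elementaryStep x b * elementaryStep y b' * elementaryStep z b'' * A ∈
      lowerCosets [x, y, z] := by
  refine ⟨_, ?_, A, hA, rfl⟩
  simpa [lowerProducts, mul_assoc] using
    Set.mul_mem_mul (elementaryStep_mem_lowerSteps hb)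
      (Set.mul_mem_mul (elementaryStep_mem_lowerSteps hb') (elementaryStep_mem_lowerSteps hb''))

end LowerProducts

section KnuthRewriting

variable {n : ℕ} {x y z : Fin n} {b b' b'' : Fin n → ℂ}

theorem lowerProducts_swap_subset_lowerCosets (hxz : x < z) :
    lowerProducts [x, z] ⊆ lowerCosets [z, x] := by
  simp only [lowerProducts, List.map_cons, List.map_nil, List.prod_cons, List.prod_nil, mul_one]
  rintro _ ⟨_, ⟨b, hb, rfl⟩, _, ⟨b', hb', rfl⟩, rfl⟩
  set b₁ := b - b z • (Pi.single z 1 + b') with hb₁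
  have hb₁_le : ∀ l ≤ x, b₁ l = 0 := fun l hl => by
    simp [hb₁, hb l hl, hb' l (hl.trans hxz.le), (hl.trans_lt hxz).ne]
  have hslide := elementaryStep_add_smul_mul hxz.ne b₁ (hb' x hxz.le) (hb' z le_rfl) (b z)
  have hcomm := commute_elementaryStep hxz.ne (hb' x hxz.le) (hb' z le_rfl) (hb₁_le x le_rfl)
    (by simp [hb₁, hb' z le_rfl])
  rw [hb₁, sub_add_cancel, ← hb₁, ← hcomm.eq] at hslide
  dsimp only
  rw [hslide]
  exact elementaryStep_mul_mem_lowerCosets hb' hb₁_le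
    (mapGL_constShear_mem_integralLowerUnipotent fun _ hl =>
      Pi.single_eq_of_ne (hl.trans_lt hxz).ne _)

theorem elementaryStep_zxy_mem_lowerCosets (hxy : x < y) (hyz : y ≤ z)
    (hb : ∀ l ≤ z, b l = 0) (hb' : ∀ l ≤ x, b' l = 0) (hb'' : ∀ l ≤ y, b'' l = 0)
    (hne : (Pi.single y 1 + b'' : Fin n → ℂ) z ≠ 0) :
    elementaryStep z b * elementaryStep x b' * elementaryStep y b'' ∈ lowerCosets [x, z, y] := by
  have hxz := hxy.trans_le hyz
  set e : Fin n → ℂ := Pi.single y 1 + b'' with he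
  set ρ := b' z / e z
  set b₁ := b' - ρ • e with hb₁
  have hb₁_le : ∀ l ≤ x, b₁ l = 0 := fun l hl => by
    simp [hb₁, he, hb' l hl, hb'' l (hl.trans hxy.le), (hl.trans_lt hxy).ne]
  have hb₁_z : b₁ z = 0 := by simp [hb₁, ρ, hne]
  have hslide := elementaryStep_add_smul_mul hxy.ne b₁ (hb'' x hxy.le) (hb'' y le_rfl) ρ
  have hcomm := commute_elementaryStep hxz.ne (hb x hxz.le) (hb z le_rfl) (hb₁_le x le_rfl) hb₁_z
  rw [← he, hb₁, sub_add_cancel, ← hb₁] at hslide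
  rw [mul_assoc, hslide, ← mul_assoc, ← mul_assoc, hcomm.eq]
  exact elementaryStep_mul_mem_lowerCosets_three hb₁_le hb hb''
    (mapGL_constShear_mem_integralLowerUnipotent fun _ hl =>
      Pi.single_eq_of_ne (hl.trans_lt hxy).ne _)

theorem mapGL_constShear_mul_elementaryStep (hxy : x ≠ y) {d : Fin n → ℂ} (hdx : d x = 0)
    (hdy : d y = 0) (hbx : b x = 0) :
    mapGL ℂ⸨X⸩ (constShear y d) * elementaryStep x b =
      elementaryStep x (b + b y • d) * mapGL ℂ⸨X⸩ (constShear y d) := by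
  have hshear : mapGL ℂ⸨X⸩ (constShear y d) * mapGL ℂ⸨X⸩ (constShear x b) =
      mapGL ℂ⸨X⸩ (constShear x (b + b y • d)) * mapGL ℂ⸨X⸩ (constShear y d) :=
    mul_mapGL_constShear (u := 1)
      (fun v => by rw [mapGL_constShear_mulVec hdy]; simp [hdx])
      (fun l => by rw [mapGL_constShear_mulVec hdy]; simp) hbx (by simp [hbx, hdx])
  rw [elementaryStep, ← mul_assoc, hshear, mul_assoc,
    ← (commute_tPow_mapGL_constShear hxy hdy hdx).eq, ← mul_assoc, elementaryStep]

theorem exists_elementaryStep_eq_mul_mul (hxy : x ≤ y) (hyz : y < z) (hb : ∀ l ≤ x, b l = 0)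
    (hne : (Pi.single x 1 + b : Fin n → ℂ) y ≠ 0) :
    ∃ r : ℂ, ∃ A ∈ integralLowerUnipotent n, elementaryStep x b =
      mapGL ℂ⸨X⸩ (constShear y (Pi.single z r)) * elementaryStep x (Function.update b z 0) * A := by
  have hupdate : Function.update b z 0 + Pi.single z (b z) = b := by
    ext l
    obtain rfl | hl := eq_or_ne l z <;> simp [*]
  rcases hxy.eq_or_lt with rfl | hxy
  · refine ⟨b z, 1, one_mem _, ?_⟩
    rw [mul_one, ← elementaryStep_add, add_comm, hupdate]
  · have hxz := hxy.trans hyz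
    have hby : b y ≠ 0 := by simpa [hxy.ne'] using hne
    have hconj := mapGL_constShear_mul_elementaryStep (b := Function.update b z 0)
      (d := Pi.single z (b z / b y)) hxy.ne (by simp [hxz.ne]) (by simp [hyz.ne])
      (by simp [hxz.ne, hb])
    have hparam :
        Function.update b z 0 + Function.update b z 0 y • Pi.single z (b z / b y) = b := by
      rw [Function.update_of_ne hyz.ne, ← Pi.single_smul, smul_eq_mul, mul_div_cancel₀ _ hby,
        hupdate]
    refine ⟨b z / b y, _, mapGL_constShear_mem_integralLowerUnipotent (i := y)
      (b := -Pi.single z (b z / b y)) fun l hl => by simp [(hl.trans_lt hyz).ne], ?_⟩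
    rw [hconj, hparam, constShear_neg, map_inv, mul_inv_cancel_right]

theorem elementaryStep_yzx_mem_lowerCosets (hxy : x ≤ y) (hyz : y < z)
    (hb : ∀ l ≤ y, b l = 0) (hb' : ∀ l ≤ z, b' l = 0) (hb'' : ∀ l ≤ x, b'' l = 0)
    (hne : (Pi.single x 1 + b'' : Fin n → ℂ) y ≠ 0) :
    elementaryStep y b * elementaryStep z b' * elementaryStep x b'' ∈ lowerCosets [y, x, z] := by
  have hxz := hxy.trans_lt hyz
  obtain ⟨r, A, hA, hfactor⟩ := exists_elementaryStep_eq_mul_mul hxy hyz hb'' hne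
  set b₀ := Function.update b'' z 0 with hb₀
  have hb₀_le : ∀ l ≤ x, b₀ l = 0 := fun l hl => by
    simp [hb₀, Function.update_of_ne (hl.trans_lt hxz).ne, hb'' l hl]
  have hcomm := commute_elementaryStep hxz.ne (hb' x hxz.le) (hb' z le_rfl) (hb₀_le x le_rfl)
    (Function.update_self z 0 b'')
  have hslide := elementaryStep_add_smul_mul hyz.ne b (hb' y hyz.le) (hb' z le_rfl) r
  have hproduct : elementaryStep y b * elementaryStep z b' * elementaryStep x b'' =
      elementaryStep y (b + r • (Pi.single z 1 + b')) * elementaryStep x b₀ *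
        elementaryStep z b' * A :=
    calc _ = elementaryStep y b * elementaryStep z b' *
          mapGL ℂ⸨X⸩ (constShear y (Pi.single z r)) * elementaryStep x b₀ * A := by
            rw [hfactor]
            simp only [mul_assoc]
      _ = elementaryStep y (b + r • (Pi.single z 1 + b')) *
          (elementaryStep z b' * elementaryStep x b₀) * A := by
            rw [← hslide, mul_assoc _ _ (elementaryStep x b₀)]
      _ = _ := by rw [hcomm.eq, ← mul_assoc]
  rw [hproduct]
  refine elementaryStep_mul_mem_lowerCosets_three (fun l hl => ?_) hb₀_le hb' hA
  simp [hb l hl, hb' l (hl.trans hyz.le), (hl.trans_lt hyz).ne]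

end KnuthRewriting

section ShearLimits

variable {n : ℕ}

/-- The elements `A B` for which infinitely many members of some one-parameter family
`A (1 + s ∑_l b_l E_{l i}) B`, `s ∈ ℂ`, lie in `E`. Their classes in `𝒢'` are Zariski limits of
classes of elements of `E`. -/
def shearLimits (E : Set (GL (Fin n) ℂ⸨X⸩)) : Set (GL (Fin n) ℂ⸨X⸩) :=
  {g | ∃ A B i, ∃ b : Fin n → ℂ, g = A * B ∧
    {s : ℂ | A * mapGL ℂ⸨X⸩ (constShear i (s • b)) * B ∈ E}.Infinite}

theorem shearLimits_mono {E F : Set (GL (Fin n) ℂ⸨X⸩)} (h : E ⊆ F) :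
    shearLimits E ⊆ shearLimits F := by
  rintro _ ⟨A, B, i, b, rfl, hinf⟩
  exact ⟨A, B, i, b, rfl, hinf.mono fun _ hs => h hs⟩

theorem mul_shearLimits_mul_subset (P E Q : Set (GL (Fin n) ℂ⸨X⸩)) :
    P * shearLimits E * Q ⊆ shearLimits (P * E * Q) := by
  rintro _ ⟨_, ⟨p, hp, _, ⟨A, B, i, b, rfl, hinf⟩, rfl⟩, q, hq, rfl⟩
  refine ⟨p * A, B * q, i, b, by simp only [mul_assoc], hinf.mono fun s hs => ?_⟩
  have hmem := Set.mul_mem_mul (Set.mul_mem_mul hp (show _ ∈ E from hs)) hq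
  simpa only [mul_assoc, Set.mem_ofPred_eq] using hmem

theorem elementaryStep_mul_mem_shearLimits {E : Set (GL (Fin n) ℂ⸨X⸩)} {i j : Fin n} (hij : i ≤ j)
    {A : GL (Fin n) ℂ⸨X⸩} {b : Fin n → ℂ} (hb : ∀ l ≤ i, b l = 0)
    (hgen : ∀ b : Fin n → ℂ, (∀ l ≤ i, b l = 0) → (Pi.single i 1 + b : Fin n → ℂ) j ≠ 0 →
      A * elementaryStep i b ∈ E) :
    A * elementaryStep i b ∈ shearLimits E := by
  rcases hij.eq_or_lt with rfl | hij
  · refine ⟨A, elementaryStep i b, i, 0, rfl, Set.infinite_univ.mono fun s _ => ?_⟩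
    simpa using hgen b hb (by simp [hb])
  · refine ⟨A, elementaryStep i b, i, Pi.single j 1, rfl,
      (Set.finite_singleton (-b j)).infinite_compl.mono fun s hs => ?_⟩
    rw [Set.mem_ofPred_eq, mul_assoc, ← elementaryStep_add]
    refine hgen _ (fun l hl => by simp [hb l hl, (hl.trans_lt hij).ne]) ?_
    simpa [hij.ne', add_eq_zero_iff_eq_neg] using hs

theorem lowerProducts_zxy_subset_shearLimits {x y z : Fin n} (hxy : x < y) (hyz : y ≤ z) :
    lowerProducts [z, x, y] ⊆ shearLimits (lowerCosets [x, z, y]) := by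
  simp only [lowerProducts, List.map_cons, List.map_nil, List.prod_cons, List.prod_nil, mul_one,
    ← mul_assoc]
  rintro _ ⟨_, ⟨_, ⟨b, hb, rfl⟩, _, ⟨b', hb', rfl⟩, rfl⟩, _, ⟨b'', hb'', rfl⟩, rfl⟩
  exact elementaryStep_mul_mem_shearLimits hyz hb'' fun d hd hne =>
    elementaryStep_zxy_mem_lowerCosets hxy hyz hb hb' hd hne

theorem lowerProducts_yzx_subset_shearLimits {x y z : Fin n} (hxy : x ≤ y) (hyz : y < z) :
    lowerProducts [y, z, x] ⊆ shearLimits (lowerCosets [y, x, z]) := by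
  simp only [lowerProducts, List.map_cons, List.map_nil, List.prod_cons, List.prod_nil, mul_one,
    ← mul_assoc]
  rintro _ ⟨_, ⟨_, ⟨b, hb, rfl⟩, _, ⟨b', hb', rfl⟩, rfl⟩, _, ⟨b'', hb'', rfl⟩, rfl⟩
  exact elementaryStep_mul_mem_shearLimits hxy hb'' fun d hd hne =>
    elementaryStep_yzx_mem_lowerCosets hxy hyz hb hb' hd hne

theorem lowerProducts_mul_lowerCosets_mul_subset (v w u : List (Fin n)) :
    lowerProducts v * lowerCosets w * lowerProducts u ⊆ lowerCosets (v ++ w ++ u) :=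
  calc lowerProducts v * lowerCosets w * lowerProducts u
      ⊆ lowerCosets v * lowerCosets w * lowerCosets u :=
        Set.mul_subset_mul (Set.mul_subset_mul_right (lowerProducts_subset_lowerCosets v))
          (lowerProducts_subset_lowerCosets u)
    _ ⊆ lowerCosets (v ++ w) * lowerCosets u :=
        Set.mul_subset_mul_right (lowerCosets_mul_lowerCosets v w)
    _ ⊆ lowerCosets (v ++ w ++ u) := lowerCosets_mul_lowerCosets _ u

theorem lowerProducts_infix_subset_lowerCosets {w w' : List (Fin n)}
    (h : lowerProducts w ⊆ lowerCosets w') (v u : List (Fin n)) :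
    lowerProducts (v ++ w ++ u) ⊆ lowerCosets (v ++ w' ++ u) := by
  rw [lowerProducts_append, lowerProducts_append]
  exact (Set.mul_subset_mul_right (Set.mul_subset_mul_left h)).trans
    (lowerProducts_mul_lowerCosets_mul_subset v w' u)

theorem lowerProducts_infix_subset_shearLimits {w w' : List (Fin n)}
    (h : lowerProducts w ⊆ shearLimits (lowerCosets w')) (v u : List (Fin n)) :
    lowerProducts (v ++ w ++ u) ⊆ shearLimits (lowerCosets (v ++ w' ++ u)) := by
  rw [lowerProducts_append, lowerProducts_append]
  exact (Set.mul_subset_mul_right (Set.mul_subset_mul_left h)).trans <|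
    (mul_shearLimits_mul_subset _ _ _).trans <|
      shearLimits_mono (lowerProducts_mul_lowerCosets_mul_subset v w' u)

end ShearLimits

theorem eval_add_smul_eq_zero {σ K : Type*} [Field K] {p : MvPolynomial σ K} {v v' : σ → K}
    {S : Set K} (hS : S.Infinite) (h : ∀ s ∈ S, MvPolynomial.eval (v + s • v') p = 0) (s : K) :
    MvPolynomial.eval (v + s • v') p = 0 := by
  set q : Polynomial K :=
    MvPolynomial.aeval (fun i => Polynomial.C (v i) + Polynomial.X * Polynomial.C (v' i)) p
  have heval (s : K) : q.eval s = MvPolynomial.eval (v + s • v') p := by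
    rw [← Polynomial.coe_evalRingHom, show q = _ from MvPolynomial.aeval_def _ _,
      MvPolynomial.hom_eval₂, MvPolynomial.eval, MvPolynomial.coe_eval₂Hom]
    congr 1
    · ext; simp
    · ext; simp [mul_comm s]
  have hzero : q = 0 := Polynomial.eq_zero_of_infinite_isRoot q <|
    hS.mono fun s hs => (heval s).trans (h s hs)
  rw [← heval, hzero, Polynomial.eval_zero]

section Zariski

variable {n : ℕ} {Z : Set (AffineGrassmannian n)}

theorem exists_forall_ofGL_mem_iff_eval_eq_zero (hZ : IsClosed Z) (a : ℕ) :
    ∃ s : Set (MvPolynomial ((Fin n × Fin n × ℤ) ⊕ (Fin n × Fin n × ℤ)) ℂ),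
      ∀ g ∈ boundedGL n a, AffineGrassmannian.ofGL g ∈ Z ↔
        ∀ p ∈ s, MvPolynomial.eval (coordinates g) p = 0 := by
  have hGL : IsClosed[zariskiGL n] (AffineGrassmannian.ofGL ⁻¹' Z) := isClosed_coinduced.1 hZ
  have hbounded := isClosed_coinduced.1 (isClosed_iSup_iff.1 hGL a)
  obtain ⟨T, hT, hTZ⟩ := (@isClosed_induced_iff _ _ (zariski _) _ _).1 hbounded
  obtain ⟨U, hU, rfl⟩ := isClosed_induced_iff.1 hT
  obtain ⟨s, rfl⟩ := (PrimeSpectrum.isClosed_iff_zeroLocus _).1 hU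
  refine ⟨s, fun g hg => ?_⟩
  have hiff := Set.ext_iff.1 hTZ ⟨g, hg⟩
  simp only [Set.mem_preimage, PrimeSpectrum.mem_zeroLocus] at hiff
  rw [← hiff]
  exact forall₂_congr fun p _ => MvPolynomial.mem_vanishingIdeal_singleton_iff _ _

theorem exists_forall_lt_neg_coeff_eq_zero {ι : Type*} [Finite ι] (f : ι → ℂ⸨X⸩) :
    ∃ a : ℕ, ∀ i, ∀ k : ℤ, k < -(a : ℤ) → (f i).coeff k = 0 := by
  cases nonempty_fintype ι
  refine ⟨∑ i, (f i).order.natAbs, fun i k hk => HahnSeries.coeff_eq_zero_of_lt_order ?_⟩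
  have hle : (f i).order.natAbs ≤ ∑ i, (f i).order.natAbs :=
    Finset.single_le_sum (f := fun i => (f i).order.natAbs) (fun _ _ => Nat.zero_le _)
      (Finset.mem_univ i)
  omega

theorem ofGL_mem_of_affine_line (hZ : IsClosed Z) {g : ℂ → GL (Fin n) ℂ⸨X⸩}
    {M M' N N' : Matrix (Fin n) (Fin n) ℂ⸨X⸩} (hg : ∀ s, (g s).1 = M + s • M')
    (hg' : ∀ s, (g s)⁻¹.1 = N + s • N') {S : Set ℂ} (hS : S.Infinite)
    (h : ∀ s ∈ S, AffineGrassmannian.ofGL (g s) ∈ Z) (s : ℂ) :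
    AffineGrassmannian.ofGL (g s) ∈ Z := by
  obtain ⟨a, ha⟩ := exists_forall_lt_neg_coeff_eq_zero
    (fun v : (Fin 4) × Fin n × Fin n => ![M, M', N, N'] v.1 v.2.1 v.2.2)
  have hbounded (s : ℂ) : g s ∈ boundedGL n a := fun l m k hk => by
    have hpole (c) := ha (c, l, m) k hk
    simp only [hg, hg', Matrix.add_apply, Matrix.smul_apply,
      HahnSeries.coeff_add, HahnSeries.coeff_smul]
    rw [show (M l m).coeff k = 0 from hpole 0, show (M' l m).coeff k = 0 from hpole 1,
      show (N l m).coeff k = 0 from hpole 2, show (N' l m).coeff k = 0 from hpole 3]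
    simp
  have hcoordinates (s : ℂ) : coordinates (g s) =
      Sum.elim (fun v => (M v.1 v.2.1).coeff v.2.2) (fun v => (N v.1 v.2.1).coeff v.2.2) +
        s • Sum.elim (fun v => (M' v.1 v.2.1).coeff v.2.2)
          (fun v => (N' v.1 v.2.1).coeff v.2.2) := by
    ext (v | v)
    · simp [coordinates, hg]
    · simp only [coordinates, hg', Sum.elim_inr]
      simp
  obtain ⟨P, hP⟩ := exists_forall_ofGL_mem_iff_eval_eq_zero hZ a
  refine (hP _ (hbounded s)).2 fun p hp => ?_
  rw [hcoordinates]
  refine eval_add_smul_eq_zero hS (fun s hs => ?_) s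
  rw [← hcoordinates]
  exact (hP _ (hbounded s)).1 (h s hs) p hp

theorem mul_smul_mul (A M B : Matrix (Fin n) (Fin n) ℂ⸨X⸩) (s : ℂ) :
    A * s • M * B = s • (A * M * B) := by
  rw [mul_assoc, mul_assoc]
  ext l m : 1
  simp only [Matrix.mul_apply, Matrix.smul_apply, ← HahnSeries.C_mul_eq_smul,
    Finset.mul_sum, mul_left_comm _ (HahnSeries.C s), mul_assoc]

theorem mapGL_constShear_smul_val (i : Fin n) (b : Fin n → ℂ) (s : ℂ) :
    (mapGL ℂ⸨X⸩ (constShear i (s • b))).1 =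
      1 + s • ((mapGL ℂ⸨X⸩ (constShear i b)).1 - 1) := by
  rw [mapGL_constShear_val, mapGL_constShear_val, shear, shear, add_sub_cancel_left]
  ext l m : 1
  obtain rfl | hl := eq_or_ne l i <;> simp [vecMulVec_apply, *, mul_smul]

theorem ofGL_image_shearLimits_subset (E : Set (GL (Fin n) ℂ⸨X⸩)) :
    AffineGrassmannian.ofGL '' shearLimits E ⊆ closure (AffineGrassmannian.ofGL '' E) := by
  rintro _ ⟨_, ⟨A, B, i, b, rfl, hinf⟩, rfl⟩
  have hline (s : ℂ) : (A * mapGL ℂ⸨X⸩ (constShear i (s • b)) * B).1 = A.1 * B.1 +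
      s • (A.1 * ((mapGL ℂ⸨X⸩ (constShear i b)).1 - 1) * B.1) := by
    rw [Units.val_mul, Units.val_mul, mapGL_constShear_smul_val, mul_add, add_mul, mul_one,
      mul_smul_mul]
  have hline_inv (s : ℂ) : (A * mapGL ℂ⸨X⸩ (constShear i (s • b)) * B)⁻¹.1 = B⁻¹.1 * A⁻¹.1 +
      s • (B⁻¹.1 * ((mapGL ℂ⸨X⸩ (constShear i (-b))).1 - 1) * A⁻¹.1) := by
    rw [_root_.mul_inv_rev, _root_.mul_inv_rev, ← map_inv, ← constShear_neg, ← smul_neg,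
      ← mul_assoc, Units.val_mul, Units.val_mul, mapGL_constShear_smul_val, mul_add, add_mul,
      mul_one, mul_smul_mul]
  simpa using ofGL_mem_of_affine_line
    (isClosed_closure (s := AffineGrassmannian.ofGL '' E)) hline hline_inv hinf
    (fun s hs => subset_closure ⟨_, hs, rfl⟩) 0

theorem ofGL_mul_mapGL (g : GL (Fin n) ℂ⸨X⸩) (h : SL(n, ℂ⟦X⟧)) :
    AffineGrassmannian.ofGL (g * mapGL ℂ⸨X⸩ h) = AffineGrassmannian.ofGL g := by
  rw [AffineGrassmannian.ofGL, map_mul]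
  exact QuotientGroup.mk_mul_of_mem _ ⟨toGL h, congrArg ProjGenLinGroup.mk (Units.ext rfl)⟩

theorem ofGL_image_lowerCosets (w : List (Fin n)) :
    AffineGrassmannian.ofGL '' lowerCosets w = AffineGrassmannian.ofGL '' lowerProducts w := by
  refine Set.Subset.antisymm ?_ (Set.image_mono (lowerProducts_subset_lowerCosets w))
  rintro _ ⟨_, ⟨g, hg, _, ⟨h, -, rfl⟩, rfl⟩, rfl⟩
  exact ⟨g, hg, (ofGL_mul_mapGL g h).symm⟩

theorem closure_image_lowerProducts_subset_of_subset_lowerCosets {w w' : List (Fin n)}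
    (h : lowerProducts w ⊆ lowerCosets w') :
    closure (AffineGrassmannian.ofGL '' lowerProducts w) ⊆
      closure (AffineGrassmannian.ofGL '' lowerProducts w') := by
  rw [← ofGL_image_lowerCosets w']
  exact closure_mono (Set.image_mono h)

theorem closure_image_lowerProducts_subset_of_subset_shearLimits {w w' : List (Fin n)}
    (h : lowerProducts w ⊆ shearLimits (lowerCosets w')) :
    closure (AffineGrassmannian.ofGL '' lowerProducts w) ⊆
      closure (AffineGrassmannian.ofGL '' lowerProducts w') := by
  rw [← ofGL_image_lowerCosets w']
  exact closure_minimal ((Set.image_mono h).trans (ofGL_image_shearLimits_subset _))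
    isClosed_closure

theorem closure_image_lowerProducts_eq {w₁ w₂ : List (Fin n)} (hK : KnuthRelation w₁ w₂) :
    closure (AffineGrassmannian.ofGL '' lowerProducts w₁) =
      closure (AffineGrassmannian.ofGL '' lowerProducts w₂) := by
  cases hK with
  | xzy_zxy v₁ v₂ x y z hxy hyz =>
    refine subset_antisymm ?_ <| closure_image_lowerProducts_subset_of_subset_shearLimits <|
      lowerProducts_infix_subset_shearLimits (lowerProducts_zxy_subset_shearLimits hxy hyz) v₁ v₂
    simpa using closure_image_lowerProducts_subset_of_subset_lowerCosets <|
      lowerProducts_infix_subset_lowerCosets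
        (lowerProducts_swap_subset_lowerCosets (hxy.trans_le hyz)) v₁ (y :: v₂)
  | yzx_yxz v₁ v₂ x y z hxy hyz =>
    refine (closure_image_lowerProducts_subset_of_subset_shearLimits <|
      lowerProducts_infix_subset_shearLimits
        (lowerProducts_yzx_subset_shearLimits hxy hyz) v₁ v₂).antisymm ?_
    simpa using closure_image_lowerProducts_subset_of_subset_lowerCosets <|
      lowerProducts_infix_subset_lowerCosets
        (lowerProducts_swap_subset_lowerCosets (hxy.trans_lt hyz)) (v₁ ++ [y]) v₂

end Zariski

section Frame

variable {n : ℕ}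

theorem exists_algebraMap_eq_of_algebraMap_mul_pow_eq_one {R K : Type*} [CommRing R]
    [IsIntegrallyClosed R] [Field K] [Algebra R K] [IsFractionRing R K] {d : Rˣ} {u : K} {k : ℕ}
    (hk : 0 < k) (h : algebraMap R K d * u ^ k = 1) : ∃ y, algebraMap R K y = u := by
  refine IsIntegrallyClosed.exists_algebraMap_eq_of_isIntegral_pow hk ?_
  have hu : u ^ k = algebraMap R K ↑d⁻¹ :=
    calc u ^ k = algebraMap R K (↑d⁻¹ * d) * u ^ k := by rw [Units.inv_mul, map_one, one_mul]
      _ = algebraMap R K ↑d⁻¹ := by rw [map_mul, mul_assoc, h, mul_one]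
  rw [hu]
  exact isIntegral_algebraMap

theorem ofGL_eq_ofGL_iff {g g' : GL (Fin n) ℂ⸨X⸩} (hdet : g.det = g'.det) :
    AffineGrassmannian.ofGL g = AffineGrassmannian.ofGL g' ↔
      ∃ A : SL(n, ℂ⟦X⟧), g' = g * mapGL ℂ⸨X⸩ A := by
  refine ⟨fun h => ?_, fun ⟨A, hA⟩ => by rw [hA, ofGL_mul_mapGL]⟩
  rcases n.eq_zero_or_pos with rfl | hn
  · exact ⟨1, Units.ext (Matrix.ext fun i => i.elim0)⟩
  obtain ⟨B, hB⟩ := QuotientGroup.eq.1 h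
  rw [← map_inv, ← map_mul] at hB
  obtain ⟨u, hu⟩ := ProjGenLinGroup.mk_eq_mk_iff.1 hB
  have hscale : (g⁻¹ * g').1 = u.1 • B.1.map (algebraMap ℂ⟦X⟧ ℂ⸨X⸩) := by
    rw [← hu, smul_eq_mul_diagonal]
    rfl
  have hdetB : algebraMap ℂ⟦X⟧ ℂ⸨X⸩ (GeneralLinearGroup.det B) * u.1 ^ n = 1 := by
    have hone : (g⁻¹ * g').1.det = 1 :=
      congrArg Units.val (show (g⁻¹ * g').det = 1 by rw [map_mul, map_inv, hdet, inv_mul_cancel])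
    rw [hscale, det_smul, Fintype.card_fin, mul_comm] at hone
    rwa [GeneralLinearGroup.val_det_apply, RingHom.map_det]
  obtain ⟨y, hy⟩ := exists_algebraMap_eq_of_algebraMap_mul_pow_eq_one hn hdetB
  have hdetA : (y • B.1).det = 1 := by
    refine IsFractionRing.injective ℂ⟦X⟧ ℂ⸨X⸩ ?_
    rwa [det_smul, Fintype.card_fin, map_mul, map_pow, hy, map_one, mul_comm]
  refine ⟨⟨y • B.1, hdetA⟩, ?_⟩
  rw [eq_comm, ← eq_inv_mul_iff_mul_eq]
  refine Units.ext (Matrix.ext fun i j => ?_)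
  rw [hscale, ← hy]
  exact map_mul (algebraMap ℂ⟦X⟧ ℂ⸨X⸩) _ _

/-- The matrices `p_0 ⋯ p_{j-1} t^{-μ_j}`, for `p_j = t^{-μ_j} P_j t^{μ_j}`. -/
noncomputable def frame (c : List (Fin n)) (P : ℕ → SL(n, ℂ⟦X⟧)) : ℕ → GL (Fin n) ℂ⸨X⸩
  | 0 => 1
  | j + 1 => frame c P j * mapGL ℂ⸨X⸩ (P j) * tPow (vertex c j - vertex c (j + 1))

theorem vertex_zero (c : List (Fin n)) : vertex c 0 = 0 :=
  funext fun i => by simp [vertex]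

theorem det_frame (c : List (Fin n)) (P : ℕ → SL(n, ℂ⟦X⟧)) (j : ℕ) :
    (frame c P j).det = (tPow (-vertex c j)).det := by
  induction j with
  | zero => rw [frame, vertex_zero, neg_zero, tPow_zero]
  | succ j ih =>
    rw [frame, map_mul, map_mul, ih, det_mapGL, mul_one, ← map_mul, ← tPow_add, sub_eq_add_neg,
      neg_add_cancel_left]

theorem frame_eq_frame_mul_iff {c : List (Fin n)} {P P' A : ℕ → SL(n, ℂ⟦X⟧)} {N : ℕ} :
    (∀ j ≤ N, frame c P' j = frame c P j * mapGL ℂ⸨X⸩ (A j)) ↔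
      A 0 = 1 ∧ ∀ j < N, parahoricConj (vertex c j) ((P j)⁻¹ * A j * P' j) =
        parahoricConj (vertex c (j + 1)) (A (j + 1)) := by
  have hsucc : ∀ j, frame c P' j = frame c P j * mapGL ℂ⸨X⸩ (A j) →
      (frame c P' (j + 1) = frame c P (j + 1) * mapGL ℂ⸨X⸩ (A (j + 1)) ↔
        parahoricConj (vertex c j) ((P j)⁻¹ * A j * P' j) =
          parahoricConj (vertex c (j + 1)) (A (j + 1))) := by
    intro j hj
    rw [parahoricConj_eq_parahoricConj_iff, frame, frame, hj, map_mul, map_mul, map_inv]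
    simp only [mul_assoc, mul_right_inj, inv_mul_eq_iff_eq_mul]
  constructor
  · intro h
    refine ⟨mapGL_injective (S := ℂ⸨X⸩) ?_, fun j hj => (hsucc j (h j hj.le)).1 (h (j + 1) hj)⟩
    simpa only [frame, one_mul, map_one, eq_comm] using h 0 (Nat.zero_le _)
  · rintro ⟨hzero, h⟩ j hj
    induction j with
    | zero => rw [hzero, map_one, mul_one, frame, frame]
    | succ j ih => exact (hsucc j (ih (Nat.le_of_succ_le hj))).2 (h j hj)

end Frame

section BottSamelsonVariety

variable {n : ℕ} {c : List (Fin n)}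

/-- The tuple `(p_0, …, p_N)` with `p_j = t^{-μ_j} P_j t^{μ_j}`. -/
noncomputable def ParahoricProduct.ofIntegral (c : List (Fin n)) (P : ℕ → SL(n, ℂ⟦X⟧)) :
    ParahoricProduct c :=
  ⟨fun j => parahoricConj (vertex c j) (P j), fun _ => (range_parahoricConj _).le ⟨_, rfl⟩⟩

/-- A choice of the matrices `P_j ∈ SL_n(𝒪)` with `p_j = t^{-μ_j} P_j t^{μ_j}`, continued by `1`
beyond the last index. -/
noncomputable def ParahoricProduct.toIntegral (p : ParahoricProduct c) (j : ℕ) : SL(n, ℂ⟦X⟧) :=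
  if h : j < c.length + 1 then ((range_parahoricConj _).ge (p.mem ⟨j, h⟩)).choose else 1

theorem ParahoricProduct.parahoricConj_toIntegral (p : ParahoricProduct c)
    (j : Fin (c.length + 1)) : parahoricConj (vertex c j) (p.toIntegral j) = p.toFun j := by
  rw [toIntegral, dif_pos j.2]
  exact ((range_parahoricConj _).ge (p.mem j)).choose_spec

theorem ParahoricProduct.ofIntegral_toIntegral (p : ParahoricProduct c) :
    ofIntegral c p.toIntegral = p := by
  have h := funext p.parahoricConj_toIntegral
  obtain ⟨p, hp⟩ := p
  rwa [ofIntegral, ParahoricProduct.mk.injEq]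

theorem toGL_partialProd_mul_tPow (c : List (Fin n)) (P : ℕ → SL(n, ℂ⟦X⟧))
    (j : Fin (c.length + 1)) :
    toGL (Fin.partialProd (fun i : Fin c.length =>
      (ParahoricProduct.ofIntegral c P).toFun i.castSucc) j) * tPow (-vertex c j) =
        frame c P j := by
  induction j using Fin.induction with
  | zero => simp [frame, vertex_zero, tPow_zero]
  | succ j ih =>
    have hfactor : toGL ((ParahoricProduct.ofIntegral c P).toFun j.castSucc) =
        tPow (-vertex c j) * mapGL ℂ⸨X⸩ (P j) * tPow (vertex c j) := by
      rw [← inv_inv (tPow (vertex c j)), ← tPow_neg]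
      exact toGL_parahoricConj _ _
    rw [Fin.val_succ, frame, ← Fin.val_castSucc j, ← ih, Fin.partialProd_succ, map_mul, hfactor,
      sub_eq_add_neg, tPow_add]
    simp only [mul_assoc, Fin.val_castSucc]

theorem smul_ofGL (A : SL(n, ℂ⸨X⸩)) (g : GL (Fin n) ℂ⸨X⸩) :
    toPGL A • AffineGrassmannian.ofGL g = AffineGrassmannian.ofGL (toGL A * g) :=
  rfl

theorem partialProd_update_zero {G : Type*} [Group G] {N : ℕ} (p : Fin (N + 1) → G) (g : G)
    (j : Fin N) :
    Fin.partialProd (fun i : Fin N => Function.update p 0 (g * p 0) i.castSucc) j.succ =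
      g * Fin.partialProd (fun i : Fin N => p i.castSucc) j.succ := by
  cases N with
  | zero => exact j.elim0
  | succ N =>
    rw [Fin.partialProd_succ', Fin.partialProd_succ', ← mul_assoc]
    congr 1

namespace BottSamelson

/-- The point `[p_0, …, p_N]` with `p_j = t^{-μ_j} P_j t^{μ_j}`. -/
noncomputable def mk (c : List (Fin n)) (P : ℕ → SL(n, ℂ⟦X⟧)) : BottSamelson c :=
  Quotient.mk (bottSamelsonSetoid c) (ParahoricProduct.ofIntegral c P)

theorem mk_toIntegral (p : ParahoricProduct c) :
    mk c p.toIntegral = Quotient.mk (bottSamelsonSetoid c) p := by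
  rw [mk, p.ofIntegral_toIntegral]

theorem exists_eq_mk (x : BottSamelson c) : ∃ P, x = mk c P := by
  induction x using Quotient.ind with | _ p =>
  exact ⟨p.toIntegral, (mk_toIntegral p).symm⟩

theorem point_mk (c : List (Fin n)) (P : ℕ → SL(n, ℂ⟦X⟧)) (j : Fin (c.length + 1)) :
    (mk c P).point j = AffineGrassmannian.ofGL (frame c P j) := by
  rw [← toGL_partialProd_mul_tPow]
  rfl

theorem mk_eq_mk_of_frame {P P' : ℕ → SL(n, ℂ⟦X⟧)}
    (h : ∀ j ≤ c.length, ∃ A : SL(n, ℂ⟦X⟧), frame c P' j = frame c P j * mapGL ℂ⸨X⸩ A) :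
    mk c P = mk c P' := by
  choose! A hA using h
  obtain ⟨hzero, hstep⟩ := frame_eq_frame_mul_iff.1 hA
  have hmem : ∀ (μ : Fin n → ℤ) B, parahoricConj μ B ∈ parahoric μ :=
    fun μ B => (range_parahoricConj μ).le ⟨B, rfl⟩
  refine Quotient.sound (s := bottSamelsonSetoid c)
    ⟨fun j => parahoricConj (vertex c j) ((P j)⁻¹ * A j * P' j), fun j => ⟨hmem _ _, ?_⟩,
      hmem _ _, ?_, fun j => ?_⟩
  · change parahoricConj (vertex c j) ((P j)⁻¹ * A j * P' j) ∈ parahoric (vertex c (j + 1))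
    exact hstep j j.2 ▸ hmem _ _
  · change parahoricConj (vertex c 0) (P' 0) =
      parahoricConj (vertex c 0) (P 0) * parahoricConj (vertex c 0) ((P 0)⁻¹ * A 0 * P' 0)
    rw [hzero, ← map_mul, mul_one, mul_inv_cancel_left]
  · change parahoricConj (vertex c (j + 1)) (P' (j + 1)) =
      (parahoricConj (vertex c j) ((P j)⁻¹ * A j * P' j))⁻¹ *
        parahoricConj (vertex c (j + 1)) (P (j + 1)) *
        parahoricConj (vertex c (j + 1)) ((P (j + 1))⁻¹ * A (j + 1) * P' (j + 1))
    rw [hstep j j.2, ← map_inv, ← map_mul, ← map_mul]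
    group

theorem mk_eq_mk_iff {P P' : ℕ → SL(n, ℂ⟦X⟧)} :
    mk c P = mk c P' ↔
      ∀ j ≤ c.length, ∃ A : SL(n, ℂ⟦X⟧), frame c P' j = frame c P j * mapGL ℂ⸨X⸩ A := by
  refine ⟨fun h j hj => ?_, mk_eq_mk_of_frame⟩
  rw [← ofGL_eq_ofGL_iff (by rw [det_frame, det_frame])]
  have hpoint := congrArg (point ⟨j, Nat.lt_succ_of_le hj⟩) h
  rwa [point_mk, point_mk] at hpoint

theorem point_translate (g : parahoric (vertex c 0)) (x : BottSamelson c)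
    (j : Fin (c.length + 1)) :
    (translate g x).point j = toPGL g.1 • x.point j := by
  induction x using Quotient.ind with | _ p =>
  cases j using Fin.cases with
  | zero =>
    change toPGL (Fin.partialProd _ 0) • coweightPoint (vertex c 0) =
      toPGL g.1 • toPGL (Fin.partialProd _ 0) • coweightPoint (vertex c 0)
    rw [Fin.partialProd_zero, Fin.partialProd_zero, map_one, one_smul, parahoric_smul _ g.2]
  | succ j =>
    change toPGL (Fin.partialProd (fun i : Fin c.length =>
        Function.update p.toFun 0 (g.1 * p.toFun 0) i.castSucc) j.succ) •
        coweightPoint (vertex c j.succ) =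
      toPGL g.1 • toPGL (Fin.partialProd (fun i : Fin c.length => p.toFun i.castSucc) j.succ) •
        coweightPoint (vertex c j.succ)
    rw [partialProd_update_zero, map_mul, mul_smul]

theorem ext_point {x y : BottSamelson c} (h : ∀ j, x.point j = y.point j) : x = y := by
  obtain ⟨P, rfl⟩ := x.exists_eq_mk
  obtain ⟨P', rfl⟩ := y.exists_eq_mk
  refine mk_eq_mk_of_frame fun j hj => ?_
  rw [← ofGL_eq_ofGL_iff (by rw [det_frame, det_frame])]
  simpa only [point_mk] using h ⟨j, Nat.lt_succ_of_le hj⟩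

end BottSamelson

end BottSamelsonVariety

section Continuity

variable {n : ℕ} {c : List (Fin n)}

theorem tendsto_specialLinearGroup_iff {α : Type*} {f : α → SL(n, ℂ⟦X⟧)} {F : Filter α}
    {A : SL(n, ℂ⟦X⟧)} :
    Filter.Tendsto f F (𝓝 A) ↔ ∀ l m d,
      Filter.Tendsto (fun x => PowerSeries.coeff d ((f x).1 l m)) F
        (𝓝 (PowerSeries.coeff d (A.1 l m))) := by
  refine tendsto_subtype_rng.trans (tendsto_pi_nhds.trans ?_)
  refine forall_congr' fun l => tendsto_pi_nhds.trans (forall_congr' fun m => ?_)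
  exact PowerSeries.WithPiTopology.tendsto_iff_coeff_tendsto ℂ _ _ _

theorem continuous_specialLinearGroup_iff {α : Type*} [TopologicalSpace α] {f : α → SL(n, ℂ⟦X⟧)} :
    Continuous f ↔ ∀ l m d, Continuous fun x => PowerSeries.coeff d ((f x).1 l m) := by
  simp only [continuous_iff_continuousAt, ContinuousAt, tendsto_specialLinearGroup_iff]
  exact ⟨fun h l m d x => h x l m d, fun h x l m d => h l m d x⟩

theorem continuous_coeff_ofPowerSeries (l m : Fin n) (k : ℤ) :
    Continuous fun A : SL(n, ℂ⟦X⟧) => (HahnSeries.ofPowerSeries ℤ ℂ (A.1 l m)).coeff k := by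
  simp only [PowerSeries.coeff_coe]
  split_ifs
  · exact continuous_const
  · exact continuous_specialLinearGroup_iff.1 continuous_id l m _

theorem ParahoricProduct.continuous_coeff (j : Fin (c.length + 1)) (l m : Fin n) (k : ℤ) :
    Continuous fun p : ParahoricProduct c => ((p.toFun j).1 l m).coeff k := by
  have hcoords : Continuous fun (p : ParahoricProduct c)
      (v : Fin (c.length + 1) × Fin n × Fin n × ℤ) =>
        ((p.toFun v.1).1 v.2.1 v.2.2.1).coeff v.2.2.2 := continuous_induced_dom
  exact continuous_pi_iff.1 hcoords (j, l, m, k)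

theorem ParahoricProduct.continuous_ofIntegral (c : List (Fin n)) :
    Continuous (ofIntegral c) := by
  refine continuous_induced_rng.2 (continuous_pi fun v => ?_)
  change Continuous fun P : ℕ → SL(n, ℂ⟦X⟧) =>
    ((parahoricConj (vertex c v.1) (P v.1)).1 v.2.1 v.2.2.1).coeff v.2.2.2
  simp only [coeff_parahoricConj]
  exact (continuous_coeff_ofPowerSeries _ _ _).comp (_root_.continuous_apply (v.1 : ℕ))

theorem ParahoricProduct.continuous_toIntegral : Continuous (toIntegral (c := c)) := by
  refine continuous_pi fun j => ?_
  by_cases hj : j < c.length + 1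
  · refine continuous_specialLinearGroup_iff.2 fun l m d => ?_
    refine (continuous_coeff ⟨j, hj⟩ l m (d - vertex c j l + vertex c j m)).congr fun p => ?_
    rw [← p.parahoricConj_toIntegral, coeff_parahoricConj,
      ← add_sub_right_comm, sub_add_cancel, add_sub_cancel_right]
    exact HahnSeries.ofPowerSeries_apply_coeff _ _
  · simp only [toIntegral, dif_neg hj]
    exact continuous_const

namespace BottSamelson

theorem continuous_mk (c : List (Fin n)) : Continuous (mk c) :=
  continuous_quotient_mk'.comp (ParahoricProduct.continuous_ofIntegral c)

theorem isOpenMap_mk (c : List (Fin n)) : IsOpenMap (mk c) := by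
  refine fun U hU => isOpen_coinduced.2 (isOpen_iff_mem_nhds.2 ?_)
  rintro p ⟨P, hP, hp⟩
  choose! A hA using mk_eq_mk_iff.1 (hp.trans (mk_toIntegral p).symm)
  obtain ⟨hzero, hstep⟩ := frame_eq_frame_mul_iff.1 hA
  have hQ_continuous : Continuous fun (q : ParahoricProduct c) j =>
      A j * q.toIntegral j * ((p.toIntegral j)⁻¹ * (A j)⁻¹ * P j) :=
    continuous_pi fun j => (continuous_const.mul ((_root_.continuous_apply j).comp
      ParahoricProduct.continuous_toIntegral)).mul continuous_const
  have hpU : (fun j => A j * p.toIntegral j * ((p.toIntegral j)⁻¹ * (A j)⁻¹ * P j)) ∈ U := by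
    simpa only [mul_assoc, mul_inv_cancel_left] using hP
  filter_upwards [hQ_continuous.continuousAt.preimage_mem_nhds (hU.mem_nhds hpU)] with q hq
  refine ⟨_, hq, (mk_eq_mk_iff.2 fun j hj => ⟨A j, ?_⟩).trans (mk_toIntegral q)⟩
  refine frame_eq_frame_mul_iff.2 ⟨hzero, fun j hj => ?_⟩ j hj
  rw [← hstep j hj]
  simp only [_root_.mul_inv_rev, inv_inv, mul_assoc, inv_mul_cancel, mul_one]

end BottSamelson

end Continuity

section SignedSwap

variable {ι : Type*} [Fintype ι] [DecidableEq ι]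

/-- The permutation matrix of the transposition of `i` and `m`, with the sign of the transposition
in row `i`; it stands for the corresponding Weyl group element. -/
def signedSwap (R : Type*) [CommRing R] (i m : ι) : SpecialLinearGroup ι R :=
  ⟨diagonal (Function.update 1 i ((Equiv.swap i m).sign : R)) * (Equiv.swap i m).permMatrix R, by
    rw [det_mul, det_diagonal, Finset.prod_update_of_mem (Finset.mem_univ i), det_permutation]
    simp only [Pi.one_apply, Finset.prod_const_one, mul_one, ← Int.cast_mul, ← Units.val_mul,
      Int.units_mul_self, Units.val_one, Int.cast_one]⟩

theorem signedSwap_mulVec {R : Type*} [CommRing R] (i m : ι) (v : ι → R) (l : ι) :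
    ((signedSwap R i m).1 *ᵥ v) l =
      Function.update (1 : ι → R) i (Equiv.swap i m).sign l * v (Equiv.swap i m l) := by
  rw [signedSwap, ← mulVec_mulVec, mulVec_diagonal, permMatrix_mulVec]
  rfl

theorem map_signedSwap {R S : Type*} [CommRing R] [CommRing S] (f : R →+* S) (i m : ι) :
    SpecialLinearGroup.map f (signedSwap R i m) = signedSwap S i m := by
  refine Subtype.ext ?_
  change (_ * _ : Matrix ι ι R).map f = _ * _
  rw [Matrix.map_mul, diagonal_map (map_zero f)]
  congr 2
  · funext l
    obtain rfl | hl := eq_or_ne l i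
    · simp
    · simp [hl]
  · exact (Equiv.swap i m).toPEquiv.map_toMatrix f

end SignedSwap

section StepProduct

variable {n : ℕ}

theorem vertex_sub_vertex_succ {w : List (Fin n)} {j : ℕ} (h : j < w.length) :
    vertex w j - vertex w (j + 1) = -Pi.single w[j] 1 := by
  funext i
  simp only [vertex, List.take_succ_eq_append_getElem h, List.count_append, Pi.sub_apply,
    Pi.neg_apply, List.count_singleton, Pi.single_apply, beq_iff_eq, eq_comm (a := i)]
  split_ifs <;> simp

theorem elementaryStep_congr {i : Fin n} {b b' : Fin n → ℂ} (h : ∀ l ≠ i, b l = b' l) :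
    elementaryStep i b = elementaryStep i b' := by
  have hupdate : Function.update (PowerSeries.C ∘ b) i (0 : ℂ⟦X⟧) =
      Function.update (PowerSeries.C ∘ b') i 0 := by
    funext l
    obtain rfl | hl := eq_or_ne l i <;> simp [*]
  simp only [elementaryStep, constShear, shear, hupdate]

/-- The product of the first `j` elementary steps whose types are the letters of `w` and whose
parameters are given by `b`. -/
noncomputable def stepProduct (w : List (Fin n)) (b : Fin w.length → Fin n → ℂ) (j : ℕ) :
    GL (Fin n) ℂ⸨X⸩ :=
  ((List.ofFn fun k => elementaryStep w[k] (b k)).take j).prod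

variable {w : List (Fin n)} {b b' : Fin w.length → Fin n → ℂ}

theorem stepProduct_zero (b : Fin w.length → Fin n → ℂ) : stepProduct w b 0 = 1 := by
  rw [stepProduct, List.take_zero, List.prod_nil]

theorem stepProduct_succ (b : Fin w.length → Fin n → ℂ) {j : ℕ} (hj : j < w.length) :
    stepProduct w b (j + 1) = stepProduct w b j * elementaryStep w[j] (b ⟨j, hj⟩) := by
  rw [stepProduct, List.take_succ_eq_append_getElem (by simpa), List.prod_append,
    List.prod_singleton, List.getElem_ofFn, stepProduct]
  rfl

theorem stepProduct_congr {j : ℕ} (hj : j ≤ w.length)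
    (h : ∀ k : Fin w.length, k < j → ∀ l ≠ w[k], b k l = b' k l) :
    stepProduct w b j = stepProduct w b' j := by
  induction j with
  | zero => rw [stepProduct_zero, stepProduct_zero]
  | succ j ih =>
    rw [stepProduct_succ b hj, stepProduct_succ b' hj,
      elementaryStep_congr (i := w[j]) (h ⟨j, hj⟩ j.lt_succ_self),
      ih (Nat.le_of_succ_le hj) fun k hk => h k (hk.trans j.lt_succ_self)]

theorem stepProduct_parameters_zero {j : ℕ} (hj : j ≤ w.length) :
    stepProduct w 0 j = tPow (-vertex w j) := by
  induction j with
  | zero => rw [stepProduct_zero, vertex_zero, neg_zero, tPow_zero]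
  | succ j ih =>
    rw [stepProduct_succ 0 hj, ih (Nat.le_of_succ_le hj), Pi.zero_apply, elementaryStep,
      constShear_zero, map_one, one_mul, ← tPow_add, ← vertex_sub_vertex_succ hj, sub_eq_add_neg,
      neg_add_cancel_left]

theorem stepProduct_eq_of_forall_exists_mul
    (h : ∀ j ≤ w.length, ∃ A : SL(n, ℂ⟦X⟧), stepProduct w b j = stepProduct w b' j * mapGL ℂ⸨X⸩ A)
    {j : ℕ} (hj : j ≤ w.length) : stepProduct w b j = stepProduct w b' j := by
  induction j with
  | zero => rw [stepProduct_zero, stepProduct_zero]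
  | succ j ih =>
    obtain ⟨A, hA⟩ := h (j + 1) hj
    rw [stepProduct_succ b hj, stepProduct_succ b' hj, ih (Nat.le_of_succ_le hj)] at hA ⊢
    rw [mul_assoc, mul_right_inj] at hA
    rw [elementaryStep_congr fun l => eq_of_elementaryStep_eq hA]

theorem eq_of_forall_exists_stepProduct_eq_mul
    (h : ∀ j ≤ w.length, ∃ A : SL(n, ℂ⟦X⟧), stepProduct w b j = stepProduct w b' j * mapGL ℂ⸨X⸩ A)
    {k : Fin w.length} {l : Fin n} (hl : l ≠ w[k]) : b k l = b' k l := by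
  obtain ⟨A, hA⟩ := h (k + 1) k.2
  rw [stepProduct_succ b k.2, stepProduct_succ b' k.2,
    stepProduct_eq_of_forall_exists_mul h k.2.le, mul_assoc, mul_right_inj] at hA
  exact eq_of_elementaryStep_eq hA hl

/-- The parameters of the lower triangular elementary steps. -/
def lowerParameters (w : List (Fin n)) : Set (Fin w.length → Fin n → ℂ) :=
  {b | ∀ k, ∀ l ≤ w[k], b k l = 0}

theorem lowerProducts_eq_image (w : List (Fin n)) :
    lowerProducts w = (fun b => stepProduct w b w.length) '' lowerParameters w := by
  have hofFn : w.map lowerSteps = List.ofFn fun k : Fin w.length => lowerSteps w[k] := by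
    simp
  have hprod : ∀ b, stepProduct w b w.length =
      (List.ofFn fun k => elementaryStep w[k] (b k)).prod := fun b => by
    rw [stepProduct, List.take_of_length_le (by simp)]
  ext g
  simp only [lowerProducts, hofFn, Set.mem_prod_list_ofFn, hprod, Set.mem_image]
  constructor
  · rintro ⟨f, rfl⟩
    choose b hb hf using fun k => (f k).2
    exact ⟨b, hb, by simp only [hf]⟩
  · rintro ⟨b, hb, rfl⟩
    exact ⟨fun k => ⟨_, elementaryStep_mem_lowerSteps (hb k)⟩, rfl⟩

end StepProduct

section WeylTranslation

variable {n : ℕ} {w u : List (Fin n)}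

theorem tPow_mul_mapGL_signedSwap (i m : Fin n) :
    tPow (-Pi.single i 1) * mapGL ℂ⸨X⸩ (signedSwap ℂ⟦X⟧ i m) =
      mapGL ℂ⸨X⸩ (signedSwap ℂ⟦X⟧ i m) * tPow (-Pi.single m 1) := by
  have hval : (mapGL ℂ⸨X⸩ (signedSwap ℂ⟦X⟧ i m)).1 = (signedSwap ℂ⸨X⸩ i m).1 := by
    rw [mapGL_coe_matrix, map_signedSwap]
  refine Units.ext (Matrix.ext_of_mulVec_single fun k => funext fun l => ?_)
  rw [Units.val_mul, Units.val_mul, hval, ← mulVec_mulVec, ← mulVec_mulVec, tPow_mulVec,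
    signedSwap_mulVec, signedSwap_mulVec, tPow_mulVec, mul_left_comm]
  have hswap :
      (-Pi.single i 1 : Fin n → ℤ) l = (-Pi.single m 1 : Fin n → ℤ) (Equiv.swap i m l) := by
    simp only [Pi.neg_apply, Pi.single_apply, Equiv.swap_apply_eq_iff, Equiv.swap_apply_right]
  rw [hswap]

/-- The Weyl group element that matches the letter `w_j` of the word `w` with the `j`-th letter of
`u`; the numbering is shifted by one, and the initial element is `1`. -/
noncomputable def weylAt (w u : List (Fin n)) : ℕ → SL(n, ℂ⟦X⟧)
  | 0 => 1
  | j + 1 => if h : j < w.length ∧ j < u.length then signedSwap ℂ⟦X⟧ w[j] u[j] else 1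

theorem mapGL_weylAt_succ_mul_tPow {j : ℕ} (hw : j < w.length) (hu : j < u.length) :
    mapGL ℂ⸨X⸩ (weylAt w u (j + 1)) * tPow (-Pi.single u[j] 1) =
      tPow (-Pi.single w[j] 1) * mapGL ℂ⸨X⸩ (weylAt w u (j + 1)) := by
  rw [weylAt, dif_pos ⟨hw, hu⟩, tPow_mul_mapGL_signedSwap]

/-- The matrices `P_j` for which the frames along the center `u` are the products of elementary
steps along `w` with parameters `b`, up to Weyl group elements. -/
noncomputable def chartTuple (w u : List (Fin n)) (b : Fin w.length → Fin n → ℂ) (j : ℕ) :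
    SL(n, ℂ⟦X⟧) :=
  if h : j < w.length then
    (weylAt w u j)⁻¹ * constShear w[j] (b ⟨j, h⟩) * weylAt w u (j + 1)
  else 1

theorem frame_chartTuple (hu : u.length = w.length) (b : Fin w.length → Fin n → ℂ) {j : ℕ}
    (hj : j ≤ w.length) :
    frame u (chartTuple w u b) j = stepProduct w b j * mapGL ℂ⸨X⸩ (weylAt w u j) := by
  induction j with
  | zero => rw [frame, stepProduct_zero, weylAt, map_one, one_mul]
  | succ j ih =>
    have hju : j < u.length := hu ▸ hj
    rw [frame, ih (Nat.le_of_succ_le hj), chartTuple, dif_pos (show j < w.length from hj),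
      vertex_sub_vertex_succ hju, stepProduct_succ b hj, elementaryStep]
    simp only [map_mul, map_inv, mul_assoc, mul_inv_cancel_left,
      mapGL_weylAt_succ_mul_tPow hj hju]

end WeylTranslation

section Chart

variable {n : ℕ} {c w : List (Fin n)}

namespace BottSamelson

/-- The parametrization of a neighbourhood of the fixed point of `w` in `Σ` by the parameters of
elementary steps along `w`. -/
noncomputable def chart (w c : List (Fin n)) (b : Fin w.length → Fin n → ℂ) : BottSamelson c :=
  mk c (chartTuple w c b)

theorem point_chart (hc : c.length = w.length) (b : Fin w.length → Fin n → ℂ)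
    (j : Fin (c.length + 1)) :
    (chart w c b).point j = AffineGrassmannian.ofGL (stepProduct w b j) := by
  rw [chart, point_mk, frame_chartTuple hc b (hc ▸ Nat.le_of_lt_succ j.2), ofGL_mul_mapGL]

theorem isFixedPointOf_iff (hc : c.length = w.length) {y : BottSamelson c} :
    IsFixedPointOf w y ↔ y = chart w c 0 := by
  have hzero : ∀ j, (chart w c 0).point j = coweightPoint (vertex w j) := fun j => by
    rw [point_chart hc, stepProduct_parameters_zero (hc ▸ Nat.le_of_lt_succ j.2), coweightPoint]
  refine ⟨fun h => ext_point fun j => (h j).trans (hzero j).symm, ?_⟩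
  rintro rfl
  exact hzero

theorem chart_congr (hc : c.length = w.length) {b b' : Fin w.length → Fin n → ℂ}
    (h : ∀ k, ∀ l ≠ w[k], b k l = b' k l) : chart w c b = chart w c b' :=
  ext_point fun j => by
    rw [point_chart hc, point_chart hc,
      stepProduct_congr (hc ▸ Nat.le_of_lt_succ j.2) fun k _ => h k]

theorem eq_of_chart_eq (hc : c.length = w.length) {b b' : Fin w.length → Fin n → ℂ}
    (h : chart w c b = chart w c b') {k : Fin w.length} {l : Fin n} (hl : l ≠ w[k]) :
    b k l = b' k l := by
  refine (eq_of_forall_exists_stepProduct_eq_mul (fun j hj => ?_) hl).symm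
  obtain ⟨A, hA⟩ := mk_eq_mk_iff.1 h j (hc ▸ hj)
  rw [frame_chartTuple hc _ hj, frame_chartTuple hc _ hj] at hA
  refine ⟨weylAt w c j * A * (weylAt w c j)⁻¹, ?_⟩
  rw [map_mul, map_mul, map_inv, ← mul_assoc, ← mul_assoc, ← hA, mul_inv_cancel_right]

end BottSamelson

end Chart

section OneParameter

variable {n : ℕ} {c w : List (Fin n)}

/-- The action of the one-parameter subgroup `η` on the parameters of the elementary steps
along `w`. -/
noncomputable def scaleParameters (a : Fin n → ℤ) (w : List (Fin n)) (s : ℂˣ)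
    (b : Fin w.length → Fin n → ℂ) (k : Fin w.length) (l : Fin n) : ℂ :=
  (s ^ (a l - a w[k]) : ℂˣ) * b k l

theorem scaleParameters_scaleParameters_inv (a : Fin n → ℤ) (s : ℂˣ)
    (b : Fin w.length → Fin n → ℂ) :
    scaleParameters a w s (scaleParameters a w s⁻¹ b) = b := by
  funext k l
  rw [scaleParameters, scaleParameters, ← mul_assoc, ← Units.val_mul, ← mul_zpow, mul_inv_cancel,
    _root_.one_zpow, Units.val_one, one_mul]

variable (a : Fin n → ℤ) (ha : ∑ i, a i = 0) (s : ℂˣ)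

theorem toGL_oneParameter_mulVec (v : Fin n → ℂ⸨X⸩) (l : Fin n) :
    ((toGL (oneParameter a ha c s).1).1 *ᵥ v) l = HahnSeries.C ((s ^ a l : ℂˣ) : ℂ) * v l :=
  mulVec_diagonal _ _ _

theorem toGL_oneParameter_mul_elementaryStep (i : Fin n) (b : Fin n → ℂ) :
    toGL (oneParameter a ha c s).1 * elementaryStep i b =
      elementaryStep i (fun l => (s ^ (a l - a i) : ℂˣ) * b l) *
        toGL (oneParameter a ha c s).1 := by
  refine Units.ext (Matrix.ext_of_mulVec_single fun k => funext fun l => ?_)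
  rw [Units.val_mul, Units.val_mul, ← mulVec_mulVec, ← mulVec_mulVec, toGL_oneParameter_mulVec]
  obtain rfl | hl := eq_or_ne l i
  · rw [elementaryStep_mulVec_self, elementaryStep_mulVec_self, toGL_oneParameter_mulVec,
      mul_left_comm]
  · rw [elementaryStep_mulVec_of_ne hl, elementaryStep_mulVec_of_ne hl, toGL_oneParameter_mulVec,
      toGL_oneParameter_mulVec, _root_.zpow_sub, Units.val_mul, map_mul, map_mul]
    have hcancel : HahnSeries.C ((s ^ a i : ℂˣ) : ℂ) * HahnSeries.C (((s ^ a i)⁻¹ : ℂˣ) : ℂ) =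
        (1 : ℂ⸨X⸩) := by
      rw [← map_mul, Units.mul_inv, map_one]
    linear_combination (-HahnSeries.single (-1) 1 * (Pi.single k 1 : Fin n → ℂ⸨X⸩) i *
      HahnSeries.C (b l) * HahnSeries.C ((s ^ a l : ℂˣ) : ℂ)) * hcancel

theorem toGL_oneParameter_mul_stepProduct (b : Fin w.length → Fin n → ℂ) {j : ℕ}
    (hj : j ≤ w.length) :
    toGL (oneParameter a ha c s).1 * stepProduct w b j =
      stepProduct w (scaleParameters a w s b) j * toGL (oneParameter a ha c s).1 := by
  induction j with
  | zero => rw [stepProduct_zero, stepProduct_zero, mul_one, one_mul]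
  | succ j ih =>
    rw [stepProduct_succ b hj, stepProduct_succ _ hj, ← mul_assoc, ih (Nat.le_of_succ_le hj),
      mul_assoc, toGL_oneParameter_mul_elementaryStep, ← mul_assoc]
    rfl

theorem exists_mapGL_eq_toGL (g : parahoric (vertex c 0)) :
    ∃ A : SL(n, ℂ⟦X⟧), toGL g.1 = mapGL ℂ⸨X⸩ A := by
  obtain ⟨A, hA⟩ := (range_parahoricConj _).ge g.2
  refine ⟨A, ?_⟩
  rw [← hA, vertex_zero, parahoricConj_zero]
  rfl

namespace BottSamelson

theorem translate_chart (hc : c.length = w.length) (b : Fin w.length → Fin n → ℂ) :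
    translate (oneParameter a ha c s) (chart w c b) = chart w c (scaleParameters a w s b) := by
  obtain ⟨A, hA⟩ := exists_mapGL_eq_toGL (oneParameter a ha c s)
  refine ext_point fun j => ?_
  rw [point_translate, point_chart hc, point_chart hc, smul_ofGL,
    toGL_oneParameter_mul_stepProduct a ha s b (hc ▸ Nat.le_of_lt_succ j.2), hA, ofGL_mul_mapGL]

theorem translate_injective (g : parahoric (vertex c 0)) : Function.Injective (translate g) :=
  fun x y h => ext_point fun j => by
    rw [← smul_left_cancel_iff (toPGL g.1), ← point_translate, ← point_translate, h]

end BottSamelson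

end OneParameter

section LocalSurjectivity

variable {n : ℕ} {c w : List (Fin n)}

theorem continuous_constShear (i : Fin n) : Continuous (constShear i) := by
  refine continuous_specialLinearGroup_iff.2 fun l m d => ?_
  obtain rfl | hm := eq_or_ne m i
  · obtain rfl | hl := eq_or_ne l m
    · simp only [constShear, shear_apply_diag]
      exact continuous_const
    · simp only [constShear, shear_apply_self _ _ hl, Function.comp_apply, PowerSeries.coeff_C]
      split_ifs
      · exact _root_.continuous_apply l
      · exact continuous_const
  · simp only [constShear, shear_apply_ne _ _ hm]
    exact continuous_const

theorem tendsto_one_of_coeff_eq {α : Type*} {i : Fin n} {h Z : α → SL(n, ℂ⟦X⟧)}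
    {F : Filter α} (hZ : Filter.Tendsto Z F (𝓝 1))
    (hh : ∀ᶠ Y in F, ∀ l m (k : ℤ), (HahnSeries.ofPowerSeries ℤ ℂ ((h Y).1 l m)).coeff k =
      (HahnSeries.ofPowerSeries ℤ ℂ ((Z Y).1 l m)).coeff
        (k - Pi.single (M := fun _ => ℤ) i 1 l + Pi.single (M := fun _ => ℤ) i 1 m)) :
    Filter.Tendsto h F (𝓝 1) := by
  refine tendsto_specialLinearGroup_iff.2 fun l m d => ?_
  have hlim := ((continuous_coeff_ofPowerSeries l m
    (d - Pi.single (M := fun _ => ℤ) i 1 l + Pi.single (M := fun _ => ℤ) i 1 m)).tendsto 1).comp hZ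
  have hone : (HahnSeries.ofPowerSeries ℤ ℂ ((1 : SL(n, ℂ⟦X⟧)).1 l m)).coeff
      (d - Pi.single (M := fun _ => ℤ) i 1 l + Pi.single (M := fun _ => ℤ) i 1 m) =
        PowerSeries.coeff d ((1 : SL(n, ℂ⟦X⟧)).1 l m) := by
    rw [← HahnSeries.ofPowerSeries_apply_coeff (Γ := ℤ)]
    obtain rfl | hlm := eq_or_ne l m
    · rw [sub_add_cancel]
    · simp [hlm]
  rw [hone] at hlim
  refine hlim.congr' (hh.mono fun Y hY => ?_)
  exact (hY l m d).symm.trans (HahnSeries.ofPowerSeries_apply_coeff _ _)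

theorem eventually_exists_mul_tPow_eq_elementaryStep_mul (i : Fin n) {U : Set (Fin n → ℂ)}
    (hU : U ∈ 𝓝 0) {V : Set SL(n, ℂ⟦X⟧)} (hV : V ∈ 𝓝 1) :
    ∀ᶠ Y in 𝓝 (1 : SL(n, ℂ⟦X⟧)), ∃ b ∈ U, ∃ h ∈ V,
      mapGL ℂ⸨X⸩ Y * tPow (-Pi.single i 1) = elementaryStep i b * mapGL ℂ⸨X⸩ h := by
  have hentry : ∀ l m, Filter.Tendsto
      (fun Y : SL(n, ℂ⟦X⟧) => PowerSeries.constantCoeff (Y.1 l m)) (𝓝 1)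
        (𝓝 ((1 : Matrix (Fin n) (Fin n) ℂ) l m)) := fun l m => by
    have hcoeff := tendsto_specialLinearGroup_iff.1 (Filter.tendsto_id (x := 𝓝 1)) l m 0
    rw [PowerSeries.coeff_zero_eq_constantCoeff] at hcoeff
    simpa [Matrix.one_apply, apply_ite] using hcoeff
  have hpivot : ∀ᶠ Y : SL(n, ℂ⟦X⟧) in 𝓝 1, PowerSeries.constantCoeff (Y.1 i i) ≠ 0 :=
    (hentry i i).eventually_ne (by simp)
  let b (Y : SL(n, ℂ⟦X⟧)) (l : Fin n) : ℂ :=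
    if l = i then 0 else PowerSeries.constantCoeff (Y.1 l i) / PowerSeries.constantCoeff (Y.1 i i)
  have hb : Filter.Tendsto b (𝓝 1) (𝓝 0) := tendsto_pi_nhds.2 fun l => by
    obtain rfl | hl := eq_or_ne l i
    · simp [b]
    · have hquot := (hentry l i).div (hentry i i) (by simp)
      rw [one_apply_ne hl, zero_div] at hquot
      exact hquot.congr fun Y => (if_neg hl).symm
  have hex : ∀ Y : SL(n, ℂ⟦X⟧), PowerSeries.constantCoeff (Y.1 i i) ≠ 0 → _ := fun Y hY =>
    exists_mul_tPow_eq_elementaryStep_mul (i := i) (b := b Y) (Y := Y) fun l hl => by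
      simp only [b, if_neg hl, mul_div_cancel₀ _ hY]
  choose! h hdecomp hcoeff using hex
  have hshear : Filter.Tendsto (fun Y => constShear i (-b Y) * Y) (𝓝 1) (𝓝 1) := by
    simpa using (((continuous_constShear i).tendsto _).comp hb.neg).mul Filter.tendsto_id
  filter_upwards [hb hU, tendsto_one_of_coeff_eq hshear (hpivot.mono hcoeff) hV, hpivot]
    with Y hbU hhV hY
  exact ⟨b Y, hbU, h Y, hhV, hdecomp Y hY⟩

theorem stepProduct_update {b : Fin w.length → Fin n → ℂ} {b' : Fin n → ℂ} {k : Fin w.length}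
    {j : ℕ} (hj : j ≤ k) : stepProduct w (Function.update b k b') j = stepProduct w b j :=
  stepProduct_congr (hj.trans k.2.le) fun i hi l _ => by
    rw [Function.update_of_ne (Fin.ne_of_lt (hi.trans_le hj))]

theorem frame_succ_eq_stepProduct_mul {u : List (Fin n)} (hu : u.length = w.length) {j : ℕ}
    (hj : j < w.length)
    {P : ℕ → SL(n, ℂ⟦X⟧)} {b : Fin w.length → Fin n → ℂ} {b' : Fin n → ℂ} {h h' : SL(n, ℂ⟦X⟧)}
    (hP : frame u P j = stepProduct w b j * mapGL ℂ⸨X⸩ (h * weylAt w u j))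
    (hstep : mapGL ℂ⸨X⸩ (h * weylAt w u j * P j * (weylAt w u (j + 1))⁻¹) *
      tPow (-Pi.single w[j] 1) = elementaryStep w[j] b' * mapGL ℂ⸨X⸩ h') :
    frame u P (j + 1) = stepProduct w (Function.update b ⟨j, hj⟩ b') (j + 1) *
      mapGL ℂ⸨X⸩ (h' * weylAt w u (j + 1)) := by
  have hju : j < u.length := hu ▸ hj
  calc frame u P (j + 1)
      = stepProduct w b j * (mapGL ℂ⸨X⸩ (h * weylAt w u j * P j * (weylAt w u (j + 1))⁻¹) *
          (mapGL ℂ⸨X⸩ (weylAt w u (j + 1)) * tPow (-Pi.single u[j] 1))) := by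
        rw [frame, hP, vertex_sub_vertex_succ hju]
        simp only [map_mul, map_inv, mul_assoc, inv_mul_cancel_left]
    _ = stepProduct w b j * elementaryStep w[j] b' * mapGL ℂ⸨X⸩ (h' * weylAt w u (j + 1)) := by
        rw [mapGL_weylAt_succ_mul_tPow hj hju, ← mul_assoc (mapGL ℂ⸨X⸩ _) (tPow _), hstep, map_mul]
        simp only [mul_assoc]
    _ = _ := by
        rw [stepProduct_succ _ hj, stepProduct_update le_rfl, Function.update_self]

theorem tendsto_mul_weylAt_mul {j : ℕ} (hj : j < w.length) :
    Filter.Tendsto (fun q : SL(n, ℂ⟦X⟧) × (ℕ → SL(n, ℂ⟦X⟧)) =>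
        q.1 * weylAt w c j * q.2 j * (weylAt w c (j + 1))⁻¹)
      (𝓝 1 ×ˢ 𝓝 (chartTuple w c 0)) (𝓝 1) := by
  rw [← nhds_prod_eq]
  refine Continuous.tendsto' (((continuous_fst.mul continuous_const).mul
    ((_root_.continuous_apply (A := fun _ => SL(n, ℂ⟦X⟧)) j).comp continuous_snd)).mul
      continuous_const) _ _ ?_
  simp only [chartTuple, dif_pos hj, Pi.zero_apply, Pi.mul_apply, Function.comp_apply,
    constShear_zero, one_mul, mul_one, mul_inv_cancel_left, mul_inv_cancel]

theorem eventually_frame_eq_stepProduct_mul (hc : c.length = w.length) {U : Set (Fin n → ℂ)}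
    (hU : U ∈ 𝓝 0) {J : ℕ} (hJ : J ≤ w.length) {V : Set SL(n, ℂ⟦X⟧)} (hV : V ∈ 𝓝 1) :
    ∀ᶠ P in 𝓝 (chartTuple w c 0), ∃ b : Fin w.length → Fin n → ℂ, (∀ k, b k ∈ U) ∧
      ∀ j ≤ J, ∃ h ∈ V,
        frame c P j = stepProduct w b j * mapGL ℂ⸨X⸩ (h * weylAt w c j) := by
  induction J generalizing V with
  | zero =>
    refine .of_forall fun P => ⟨0, fun _ => mem_of_mem_nhds hU, fun j hj => ?_⟩
    obtain rfl := Nat.le_zero.1 hj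
    exact ⟨1, mem_of_mem_nhds hV, by simp [frame, stepProduct_zero, weylAt]⟩
  | succ J ih =>
    obtain ⟨V', hV', T, hT, hVT⟩ := Filter.mem_prod_iff.1 (tendsto_mul_weylAt_mul hJ
      (eventually_exists_mul_tPow_eq_elementaryStep_mul w[J] hU hV))
    filter_upwards [ih (Nat.le_of_succ_le hJ) (Filter.inter_mem hV hV'), hT] with P ⟨b, hb, hP⟩ hPT
    obtain ⟨h, ⟨-, hhV'⟩, hh⟩ := hP J le_rfl
    obtain ⟨b', hb', h', hh', hstep⟩ := hVT (Set.mk_mem_prod hhV' hPT)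
    refine ⟨Function.update b ⟨J, hJ⟩ b', fun k => ?_, fun j hj => ?_⟩
    · obtain rfl | hk := eq_or_ne k ⟨J, hJ⟩
      · simpa using hb'
      · simpa [hk] using hb k
    · obtain hj | rfl := Nat.le_or_eq_of_le_succ hj
      · obtain ⟨h, ⟨hhV, -⟩, hh⟩ := hP j hj
        exact ⟨h, hhV, by rw [stepProduct_update hj, hh]⟩
      · exact ⟨h', hh', frame_succ_eq_stepProduct_mul hc hJ hh hstep⟩

namespace BottSamelson

theorem continuous_chart (w c : List (Fin n)) : Continuous (chart w c) := by
  refine (continuous_mk c).comp (continuous_pi fun j => ?_)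
  by_cases hj : j < w.length
  · simp only [chartTuple, dif_pos hj]
    exact (continuous_const.mul ((continuous_constShear _).comp
      (_root_.continuous_apply (⟨j, hj⟩ : Fin w.length)))).mul continuous_const
  · simp only [chartTuple, dif_neg hj]
    exact continuous_const

theorem eventually_exists_eq_chart (hc : c.length = w.length) {U : Set (Fin n → ℂ)}
    (hU : U ∈ 𝓝 0) :
    ∀ᶠ x in 𝓝 (chart w c 0), ∃ b : Fin w.length → Fin n → ℂ, (∀ k, b k ∈ U) ∧ x = chart w c b := by
  filter_upwards [(isOpenMap_mk c).image_mem_nhds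
    (eventually_frame_eq_stepProduct_mul hc hU le_rfl Filter.univ_mem)]
  rintro _ ⟨P, ⟨b, hb, hP⟩, rfl⟩
  refine ⟨b, hb, mk_eq_mk_of_frame fun j hj => ?_⟩
  obtain ⟨h, -, hh⟩ := hP j (hc ▸ hj)
  refine ⟨(weylAt w c j)⁻¹ * h⁻¹ * weylAt w c j, ?_⟩
  rw [frame_chartTuple hc b (hc ▸ hj), hh]
  simp only [map_mul, map_inv, mul_assoc, mul_inv_cancel_left]

end BottSamelson

end LocalSurjectivity

section Cell

theorem neBot_comap_units_val_nhds_zero :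
    (Filter.comap Units.val (𝓝 (0 : ℂ)) : Filter ℂˣ).NeBot :=
  Filter.comap_neBot fun t ht => by
    obtain ⟨z, hzt, hz⟩ := mem_closure_iff_nhds.1 (dense_compl_singleton (0 : ℂ) 0) t ht
    exact ⟨Units.mk0 z hz, hzt⟩

theorem tendsto_units_zpow_nhds_zero {m : ℤ} (hm : 0 < m) :
    Filter.Tendsto (fun s : ℂˣ => ((s ^ m : ℂˣ) : ℂ)) (Filter.comap Units.val (𝓝 0)) (𝓝 0) := by
  lift m to ℕ using hm.le
  simp only [zpow_natCast, Units.val_pow_eq_pow_val]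
  exact ((continuous_pow m).tendsto' 0 0 (zero_pow (by omega))).comp Filter.tendsto_comap

variable {n : ℕ} {a : Fin n → ℤ} {c w : List (Fin n)}

theorem tendsto_scaleParameters (hanti : StrictMono a) {b : Fin w.length → Fin n → ℂ}
    (hb : b ∈ lowerParameters w) :
    Filter.Tendsto (fun s => scaleParameters a w s b) (Filter.comap Units.val (𝓝 0)) (𝓝 0) := by
  refine tendsto_pi_nhds.2 fun k => tendsto_pi_nhds.2 fun l => ?_
  obtain hl | hl := le_or_gt l w[k]
  · simp only [scaleParameters, hb k l hl, mul_zero]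
    exact tendsto_const_nhds
  · simpa only [scaleParameters, Pi.zero_apply, zero_mul] using
      (tendsto_units_zpow_nhds_zero (sub_pos.2 (hanti hl))).mul_const (b k l)

theorem eq_zero_of_eventually_norm_scaleParameters_le (hanti : StrictMono a)
    {b : Fin w.length → Fin n → ℂ} {k : Fin w.length} {l : Fin n} (hl : l < w[k])
    (hb : ∀ᶠ s in Filter.comap Units.val (𝓝 (0 : ℂ)), ‖scaleParameters a w s b k l‖ ≤ 1) :
    b k l = 0 := by
  have := neBot_comap_units_val_nhds_zero
  have hlim := (tendsto_units_zpow_nhds_zero (sub_pos.2 (hanti hl))).norm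
  rw [norm_zero] at hlim
  refine norm_le_zero_iff.1 (ge_of_tendsto hlim (hb.mono fun s hs => ?_))
  have hcancel : b k l = ((s ^ (a w[k] - a l) : ℂˣ) : ℂ) * scaleParameters a w s b k l := by
    rw [scaleParameters, ← mul_assoc, ← Units.val_mul, ← _root_.zpow_add, sub_add_sub_cancel,
      sub_self, zpow_zero, Units.val_one, one_mul]
  calc ‖b k l‖ = ‖((s ^ (a w[k] - a l) : ℂˣ) : ℂ)‖ * ‖scaleParameters a w s b k l‖ := by
        rw [← norm_mul, ← hcancel]
    _ ≤ ‖((s ^ (a w[k] - a l) : ℂˣ) : ℂ)‖ := mul_le_of_le_one_right (norm_nonneg _) hs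

open BottSamelson

theorem cell_subset_image_chart {ha : ∑ i, a i = 0} (hanti : StrictMono a)
    (hc : c.length = w.length) : cell a ha c w ⊆ chart w c '' lowerParameters w := by
  rintro x ⟨y, hy, hx⟩
  have := neBot_comap_units_val_nhds_zero
  rw [(isFixedPointOf_iff hc).1 hy] at hx
  have hev := hx.eventually
    (eventually_exists_eq_chart hc (Metric.closedBall_mem_nhds (0 : Fin n → ℂ) one_pos))
  obtain ⟨s₀, b₀, -, hs₀⟩ := hev.exists
  obtain ⟨b, rfl⟩ : ∃ b, x = chart w c b := by
    refine ⟨scaleParameters a w s₀⁻¹ b₀, translate_injective (oneParameter a ha c s₀) ?_⟩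
    rw [hs₀, translate_chart a ha s₀ hc, scaleParameters_scaleParameters_inv]
  have hzero : ∀ k, ∀ l < w[k], b k l = 0 := fun k l hl =>
    eq_zero_of_eventually_norm_scaleParameters_le hanti hl <| by
      filter_upwards [hev] with s ⟨b', hb', hs⟩
      rw [translate_chart a ha s hc] at hs
      rw [eq_of_chart_eq hc hs hl.ne]
      exact (norm_le_pi_norm _ l).trans (mem_closedBall_zero_iff.1 (hb' k))
  refine ⟨fun k l => if l ≤ w[k] then 0 else b k l, fun k l hl => if_pos hl,
    chart_congr hc fun k l hl => ?_⟩
  obtain hl | hl := hl.lt_or_gt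
  · rw [if_pos hl.le, hzero k l hl]
  · rw [if_neg hl.not_ge]

theorem cell_eq_image_chart {ha : ∑ i, a i = 0} (hanti : StrictMono a)
    (hc : c.length = w.length) : cell a ha c w = chart w c '' lowerParameters w := by
  refine (cell_subset_image_chart hanti hc).antisymm ?_
  rintro _ ⟨b, hb, rfl⟩
  refine ⟨chart w c 0, (isFixedPointOf_iff hc).2 rfl, ?_⟩
  simp only [translate_chart a ha _ hc]
  exact ((continuous_chart w c).tendsto 0).comp (tendsto_scaleParameters hanti hb)

theorem image_π_cell {ha : ∑ i, a i = 0} (hanti : StrictMono a) (hc : c.length = w.length) :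
    π c '' cell a ha c w = AffineGrassmannian.ofGL '' lowerProducts w := by
  rw [cell_eq_image_chart hanti hc, lowerProducts_eq_image, Set.image_image, Set.image_image]
  refine Set.image_congr fun b _ => ?_
  rw [π, point_chart hc, Fin.val_last, hc]

end Cell

theorem KnuthRelation.length_eq {n : ℕ} {w₁ w₂ : List (Fin n)} (hK : KnuthRelation w₁ w₂) :
    w₁.length = w₂.length := by
  cases hK <;> simp only [List.length_append, List.length_cons, List.length_nil]

end KnuthMV

theorem mainTheorem4 (n : ℕ) (a : Fin n → ℤ) (ha : ∑ i, a i = 0) (hanti : StrictMono a)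
    (c w₁ w₂ : List (Fin n)) (hc : c.length = w₁.length) (hK : KnuthMV.KnuthRelation w₁ w₂) :
    closure (KnuthMV.BottSamelson.π c '' KnuthMV.cell a ha c w₁) =
      closure (KnuthMV.BottSamelson.π c '' KnuthMV.cell a ha c w₂) := by
  rw [KnuthMV.image_π_cell hanti hc, KnuthMV.image_π_cell hanti (hc.trans hK.length_eq),
    KnuthMV.closure_image_lowerProducts_eq hK]
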